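/- Let $(W,S)$, $S=\{s_1,s_2,s_3\}$, be an affine Coxeter system of rank two, that is, with $m_{ij}$ the order of $s_is_j$, $(m_{12},m_{23},m_{13})$ is $(3,3,3)$ (type $\tilde A_2$), $(4,2,4)$ (type $\tilde C_2$) or $(6,2,3)$ (type $\tilde G_2$), and let $\ell$ be its length function. Let $W$ act on the Euclidean plane so that $s_1,s_2,s_3$ are the orthogonal reflections in the three sides of an open triangle $\mathscr C$ (the fundamental chamber), the sides of $s_i$ and $s_j$ meeting at the angle $\pi/m_{ij}$. Let $v_i$ be the vertex of $\mathscr C$ opposite to the side of $s_i$, and take $v_3$ as the origin. The walls are the fixed lines of the reflections in $W$. For $i=1,2$ let $\mathscr T_i$ be the connected component containing $\mathscr C$ of the complement of the union of all walls parallel to the vector $v_i$. For $g\in W$ the straight strip $g\mathscr T_i$ has as its direction the image of $v_i$ under the linear part of $g$, and its stabilizer consists of the elements of $W$ that map $g\mathscr T_i$ to itself and preserve this direction. Let $w_i$ be the element of the stabilizer of $g_i\mathscr T_i$ that acts on the middle line of this strip as the minimal translation in its (positive) direction, where $g_1=s_1$ in type $\tilde G_2$ and $g_i=1$ in all other cases.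 Put $H_i=\{w_i^n : n\ge 0\}$. Let $k$ be a commutative ring (for instance a field) and $q\in k$. Let $H_q(W,S)$ be the associative unital $k$-algebra with generators $e_w$ ($w\in W$) and relations $e_1=1$, $(e_s+1)(e_s-q)=0$ for $s\in S$, and $e_we_v=e_{wv}$ whenever $\ell(wv)=\ell(w)+\ell(v)$. For a representation $\rho$ of $H_q(W,S)$ on a $k$-module $V$ and a subset $D\subseteq W$, put $$D(\rho,u)=\sum_{w\in D}\rho(e_w)\,u^{\ell(w)}\in \mathrm{End}_k(V)[[u]];$$ this is invertible if $1\in D$. For $I\subseteq S$ let $W_I$ be the subgroup generated by $I$. Theorem. The elements $w_1$ and $w_2$ exist and are unique. For every representation $\rho$ of $H_q(W,S)$ there is an ordering of the nine factors $$H_1(\rho,u),\qquad H_2(\rho,u),\qquad W_I(\rho,u)^{(-1)^{|I|}}\quad (I\subsetneq S)$$ such that their product in this ordering is equal to $W(\rho,u)$. -/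

import Mathlib

open scoped ComplexConjugate

noncomputable section

/-! ### Affine Coxeter groups of rank two -/

/-- The three types `Ã₂`, `C̃₂`, `G̃₂` of affine Coxeter systems of rank two. -/
inductive AffineType
  | A2
  | C2
  | G2

namespace AffineType

/-- The Coxeter matrix `(m i j)`. The simple reflections `s₁, s₂, s₃` have indices `0, 1, 2`, and
`(m₁₂, m₂₃, m₁₃)` is `(3, 3, 3)`, `(4, 2, 4)`, `(6, 2, 3)` in the types `Ã₂`, `C̃₂`, `G̃₂`. -/
def coxeterMatrix : AffineType → CoxeterMatrix (Fin 3)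
  | A2 =>
    { M := !![1, 3, 3; 3, 1, 3; 3, 3, 1]
      isSymm := by ext i j; fin_cases i <;> fin_cases j <;> rfl
      diagonal := by intro i; fin_cases i <;> rfl
      off_diagonal := by intro i j; fin_cases i <;> fin_cases j <;> simp }
  | C2 =>
    { M := !![1, 4, 4; 4, 1, 2; 4, 2, 1]
      isSymm := by ext i j; fin_cases i <;> fin_cases j <;> rfl
      diagonal := by intro i; fin_cases i <;> rfl
      off_diagonal := by intro i j; fin_cases i <;> fin_cases j <;> simp }
  | G2 =>
    { M := !![1, 6, 3; 6, 1, 2; 3, 2, 1]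
      isSymm := by ext i j; fin_cases i <;> fin_cases j <;> rfl
      diagonal := by intro i; fin_cases i <;> rfl
      off_diagonal := by intro i j; fin_cases i <;> fin_cases j <;> simp }

/-! ### The geometric realization

The Euclidean plane is `ℂ` with its real inner product. The fundamental chamber is a triangle with
vertices `v₁, v₂, v₃`, where `v₃ = 0`, and with angle `π / m i j` at the vertex that is opposite to
the side number `k`, for `{i, j, k} = {1, 2, 3}`. -/

/-- The vertices `v₁, v₂, v₃` (with indices `0, 1, 2`) of the fundamental chamber. -/
def vertex : AffineType → Fin 3 → ℂ
  | A2 => ![⟨1 / 2, √3 / 2⟩, 1, 0]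
  | C2 => ![⟨1 / 2, 1 / 2⟩, 1, 0]
  | G2 => ![⟨3 / 4, √3 / 4⟩, 1, 0]

/-- The orthogonal reflection in the line through the vertices `v (i+1)` and `v (i+2)` of the
fundamental chamber (indices modulo `3`), the side opposite to `v i`. -/
def sideReflection (t : AffineType) (i : Fin 3) : ℂ ≃ᵃⁱ[ℝ] ℂ :=
  EuclideanGeometry.reflection (affineSpan ℝ {t.vertex (i + 1), t.vertex (i + 2)})

/-- The fundamental chamber: the open triangle with vertices `v₁, v₂, v₃`. -/
def chamber (t : AffineType) : Set ℂ :=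
  interior (convexHull ℝ (Set.range t.vertex))

end AffineType

theorem reflection_line_apply {a b : ℂ} (h : b - a ≠ 0) (z : ℂ) :
    EuclideanGeometry.reflection (affineSpan ℝ {a, b}) z
      = a + (b - a) / conj (b - a) * conj (z - a) := by
  have key : ∀ d v : ℂ, d ≠ 0 →
      (Submodule.span ℝ {d}).reflection v = d / conj d * conj v := by
    intro d v hd
    have hd' : conj d ≠ 0 := by simpa using hd
    rw [Submodule.reflection_singleton_apply, two_smul]
    have h1 : ((‖d‖ : ℝ) : ℂ) ^ 2 = d * conj d := by
      rw [Complex.mul_conj, Complex.normSq_eq_norm_sq]; push_cast; rfl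
    have h2 : (2 : ℂ) * ((inner ℝ d v : ℝ) : ℂ) = conj d * v + d * conj v := by
      rw [Complex.inner]
      apply Complex.ext <;> simp <;> ring
    simp only [Complex.real_smul]
    push_cast
    have h3 : ∀ r : ℂ, 2 * r = conj d * v + d * conj v →
        r / (d * conj d) * d + r / (d * conj d) * d - v = d / conj d * conj v := by
      intro r hr
      field_simp
      linear_combination hr
    have := h3 _ h2
    rw [← h1] at this
    simpa using this
  rw [EuclideanGeometry.reflection_apply_of_mem _ _ (left_mem_affineSpan_pair ℝ a b)]
  have hdir : (affineSpan ℝ {a, b}).direction = Submodule.span ℝ {b - a} := by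
    rw [direction_affineSpan, vectorSpan_pair_rev]; rfl
  have h4 : ∀ v : ℂ, (affineSpan ℝ {a, b}).direction.reflection v
      = (Submodule.span ℝ {b - a}).reflection v := by
    intro v
    simp only [Submodule.reflection_apply, hdir]
  rw [h4, key _ _ h]
  simp only [vsub_eq_sub, vadd_eq_add]
  ring

theorem reflection_line_mul_pow {a b c : ℂ} {m : ℕ} (hb : b - a ≠ 0) (hc : c - a ≠ 0)
    (h : ((b - a) * conj (c - a)) ^ m = (conj (b - a) * (c - a)) ^ m) :
    (EuclideanGeometry.reflection (affineSpan ℝ {a, b}) *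
      EuclideanGeometry.reflection (affineSpan ℝ {a, c})) ^ m = 1 := by
  have hb' : conj (b - a) ≠ 0 := (map_ne_zero _).mpr hb
  have hc' : conj (c - a) ≠ 0 := (map_ne_zero _).mpr hc
  have key : ∀ (n : ℕ) (z : ℂ), ((EuclideanGeometry.reflection (affineSpan ℝ {a, b}) *
      EuclideanGeometry.reflection (affineSpan ℝ {a, c})) ^ n) z
      = a + (((b - a) * conj (c - a)) / (conj (b - a) * (c - a))) ^ n * (z - a) := by
    intro n
    induction n with
    | zero => intro z; simp
    | succ n ih =>
      intro z
      rw [pow_succ, AffineIsometryEquiv.coe_mul, Function.comp_apply, ih,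
        AffineIsometryEquiv.coe_mul, Function.comp_apply, reflection_line_apply hb, reflection_line_apply hc, pow_succ]
      simp only [map_sub, map_mul, map_div₀, Complex.conj_conj, add_sub_cancel_left]
      simp only [map_sub] at hb' hc'
      field_simp
  ext z
  rw [key, div_pow, h, div_self (pow_ne_zero _ (mul_ne_zero hb' hc))]
  simp

theorem reflection_line_comm (a b : ℂ) :
    EuclideanGeometry.reflection (affineSpan ℝ {a, b})
      = EuclideanGeometry.reflection (affineSpan ℝ {b, a}) := by
  ext z
  exact EuclideanGeometry.eq_reflection_of_eq_subspace (by rw [Set.pair_comm]) z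

theorem AffineType.isLiftable_sideReflection (t : AffineType) :
    t.coxeterMatrix.IsLiftable t.sideReflection := by
  have h3 : (√3 : ℝ) ^ 2 = 3 := Real.sq_sqrt (by norm_num)
  have h4 : (√3 : ℝ) ^ 3 = 3 * √3 := by rw [pow_succ, h3]
  have h5 : (√3 : ℝ) ^ 4 = 9 := by rw [show 4 = 2 * 2 from rfl, pow_mul, h3]; norm_num
  have h6 : (√3 : ℝ) ^ 5 = 9 * √3 := by rw [pow_succ, h5]
  have h7 : (√3 : ℝ) ^ 6 = 27 := by rw [show 6 = 2 * 3 from rfl, pow_mul, h3]; norm_num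
  have hself : ∀ i, t.sideReflection i * t.sideReflection i = 1 := by
    intro i
    ext z
    simp [AffineType.sideReflection]
  have h01 : t.vertex 0 - t.vertex 1 ≠ 0 := by
    cases t <;> simp [AffineType.vertex, Complex.ext_iff] <;> norm_num
  have h02 : t.vertex 0 - t.vertex 2 ≠ 0 := by
    cases t <;> simp [AffineType.vertex, Complex.ext_iff]
  have h12 : t.vertex 1 - t.vertex 2 ≠ 0 := by
    cases t <;> simp [AffineType.vertex, Complex.ext_iff]
  have flip : ∀ x y : ℂ, x - y ≠ 0 → y - x ≠ 0 := fun x y h => by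
    rw [← neg_sub]; exact neg_ne_zero.mpr h
  have main : ∀ a b c : ℂ, ∀ m : ℕ, b - a ≠ 0 → c - a ≠ 0 →
      ((b - a) * conj (c - a)) ^ m = (conj (b - a) * (c - a)) ^ m →
      (EuclideanGeometry.reflection (affineSpan ℝ {a, b}) *
        EuclideanGeometry.reflection (affineSpan ℝ {a, c})) ^ m = 1 ∧
      (EuclideanGeometry.reflection (affineSpan ℝ {a, c}) *
        EuclideanGeometry.reflection (affineSpan ℝ {a, b})) ^ m = 1 := by
    intro a b c m hb hc h
    refine ⟨reflection_line_mul_pow hb hc h, reflection_line_mul_pow hc hb ?_⟩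
    rw [mul_comm (c - a), mul_comm (conj (c - a))]
    exact h.symm
  have c01 : ((t.vertex 0 - t.vertex 2) * conj (t.vertex 1 - t.vertex 2))
        ^ (t.coxeterMatrix 0 1) = (conj (t.vertex 0 - t.vertex 2) *
          (t.vertex 1 - t.vertex 2)) ^ (t.coxeterMatrix 0 1) := by
    cases t <;> apply Complex.ext <;>
      simp [AffineType.vertex, AffineType.coxeterMatrix, pow_succ] <;>
      ring_nf <;> (try simp only [h3, h4, h5, h6, h7]) <;> (try ring_nf)
  have c02 : ((t.vertex 0 - t.vertex 1) * conj (t.vertex 2 - t.vertex 1))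
        ^ (t.coxeterMatrix 0 2) = (conj (t.vertex 0 - t.vertex 1) *
          (t.vertex 2 - t.vertex 1)) ^ (t.coxeterMatrix 0 2) := by
    cases t <;> apply Complex.ext <;>
      simp [AffineType.vertex, AffineType.coxeterMatrix, pow_succ] <;>
      ring_nf <;> (try simp only [h3, h4, h5, h6, h7]) <;> (try ring_nf)
  have c12 : ((t.vertex 1 - t.vertex 0) * conj (t.vertex 2 - t.vertex 0))
        ^ (t.coxeterMatrix 1 2) = (conj (t.vertex 1 - t.vertex 0) *
          (t.vertex 2 - t.vertex 0)) ^ (t.coxeterMatrix 1 2) := by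
    cases t <;> apply Complex.ext <;>
      simp [AffineType.vertex, AffineType.coxeterMatrix, pow_succ] <;>
      ring_nf <;> (try simp only [h3, h4, h5, h6, h7]) <;> (try ring_nf)
  have e01 := main _ _ _ _ h02 h12 c01
  have e02 := main _ _ _ _ h01 (flip _ _ h12) c02
  have e12 := main _ _ _ _ (flip _ _ h01) (flip _ _ h02) c12
  have s0 : t.sideReflection 0
      = EuclideanGeometry.reflection (affineSpan ℝ {t.vertex 1, t.vertex 2}) := rfl
  have s1 : t.sideReflection 1
      = EuclideanGeometry.reflection (affineSpan ℝ {t.vertex 2, t.vertex 0}) := rfl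
  have s2 : t.sideReflection 2
      = EuclideanGeometry.reflection (affineSpan ℝ {t.vertex 0, t.vertex 1}) := rfl
  rw [reflection_line_comm (t.vertex 2) (t.vertex 1), ← s0, ← s1] at e01
  rw [reflection_line_comm (t.vertex 1) (t.vertex 0), ← s0, ← s2] at e02
  rw [reflection_line_comm (t.vertex 0) (t.vertex 2), ← s1, ← s2] at e12
  have hd : ∀ i, (t.sideReflection i * t.sideReflection i) ^ t.coxeterMatrix i i = 1 := by
    intro i
    rw [hself, one_pow]
  have hsymm : ∀ i j, t.coxeterMatrix i j = t.coxeterMatrix j i :=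
    fun i j => t.coxeterMatrix.symmetric i j
  intro i j
  fin_cases i <;> fin_cases j
  · exact hd 0
  · exact e01.2
  · exact e02.2
  · exact (hsymm 1 0) ▸ e01.1
  · exact hd 1
  · exact e12.2
  · exact (hsymm 2 0) ▸ e02.1
  · exact (hsymm 2 1) ▸ e12.1
  · exact hd 2

section Geometry

variable {W : Type*} [Group W] {t : AffineType} (cs : CoxeterSystem t.coxeterMatrix W)

/-- The action of `W` on the Euclidean plane: the simple reflection `sᵢ` acts as the orthogonal
reflection in the `i`-th side of the fundamental chamber. -/
def planeAction : W →* (ℂ ≃ᵃⁱ[ℝ] ℂ) :=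
  cs.lift ⟨t.sideReflection, t.isLiftable_sideReflection⟩

/-- The wall of a reflection `r` of `W`: its set of fixed points in the plane. -/
def wall (r : W) : Set ℂ := {z | planeAction cs r z = z}

/-- The union of all walls that are parallel to the vector `d`. -/
def parallelWalls (d : ℂ) : Set ℂ :=
  {z | ∃ r, cs.IsReflection r ∧ (∀ x ∈ wall cs r, x + d ∈ wall cs r) ∧ z ∈ wall cs r}

/-- The fundamental straight strip `𝒯ᵢ` (`i = 1, 2`, with indices `0, 1`): the connected component
containing the fundamental chamber of the complement of the walls parallel to the vector `vᵢ`. -/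
def fundamentalStrip (i : Fin 2) : Set ℂ :=
  ⋃ z ∈ t.chamber, connectedComponentIn (parallelWalls cs (t.vertex i.castSucc))ᶜ z

/-- The straight strip `g 𝒯ᵢ`. -/
def strip (g : W) (i : Fin 2) : Set ℂ := planeAction cs g '' fundamentalStrip cs i

/-- The direction of the straight strip `g 𝒯ᵢ`: the image of `vᵢ` under the linear part of `g`. -/
def stripDirection (g : W) (i : Fin 2) : ℂ :=
  (planeAction cs g).linearIsometryEquiv (t.vertex i.castSucc)

/-- The stabilizer of the straight strip `g 𝒯ᵢ`: the elements of `W` that map the strip to itself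
and preserve its direction. -/
def stripStabilizer (g : W) (i : Fin 2) : Subgroup W where
  carrier := {w | planeAction cs w '' strip cs g i = strip cs g i ∧
    (planeAction cs w).linearIsometryEquiv (stripDirection cs g i) = stripDirection cs g i}
  one_mem' := by
    refine ⟨by simp, ?_⟩
    rw [map_one]
    rfl
  mul_mem' := by
    rintro a b ⟨ha, ha'⟩ ⟨hb, hb'⟩
    refine ⟨?_, ?_⟩
    · rw [map_mul, AffineIsometryEquiv.coe_mul, Set.image_comp, hb, ha]
    · rw [map_mul]
      change (planeAction cs a).linearIsometryEquiv ((planeAction cs b).linearIsometryEquiv _) = _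
      rw [hb', ha']
  inv_mem' := by
    rintro a ⟨ha, ha'⟩
    refine ⟨?_, ?_⟩
    · conv_lhs => rw [← ha]
      rw [← Set.image_comp, ← AffineIsometryEquiv.coe_mul, ← map_mul, inv_mul_cancel]
      simp
    · rw [map_inv]
      change (planeAction cs a).linearIsometryEquiv.symm _ = _
      rw [LinearIsometryEquiv.symm_apply_eq, ha']

/-- The middle line of a strip: the set of its centres of symmetry. -/
def middleLine (T : Set ℂ) : Set ℂ := {z | Equiv.pointReflection z '' T = T}

/-- `w` acts on the middle line of the straight strip `g 𝒯ᵢ` as the translation by `c` times the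
direction of the strip. -/
def TranslatesMiddleLine (g : W) (i : Fin 2) (w : W) (c : ℝ) : Prop :=
  ∀ z ∈ middleLine (strip cs g i), planeAction cs w z = z + c • stripDirection cs g i

/-- `w` is the element of the stabilizer of the straight strip `g 𝒯ᵢ` that acts on the middle line
as the minimal translation in the (positive) direction of the strip. -/
def IsMinimalTranslation (g : W) (i : Fin 2) (w : W) : Prop :=
  w ∈ stripStabilizer cs g i ∧ ∃ c : ℝ, 0 < c ∧ TranslatesMiddleLine cs g i w c ∧
    ∀ w' ∈ stripStabilizer cs g i, ∀ c' : ℝ, 0 < c' → TranslatesMiddleLine cs g i w' c' → c ≤ c'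

/-- The element `g` such that `g 𝒯ᵢ` is the standard straight strip of type `i`: it is `s₁` for
`i = 1` in the type `G̃₂`, and `1` in all other cases. -/
def standardShift (i : Fin 2) : W :=
  match t, i with
  | .G2, 0 => cs.simple 0
  | _, _ => 1

/-- `w` is the generator `wᵢ` of the stabilizer of the standard straight strip of type `i`. -/
def IsStripGenerator (i : Fin 2) (w : W) : Prop :=
  IsMinimalTranslation cs (standardShift cs i) i w

end Geometry

/-! ### Hecke algebras and twisted Poincaré series -/

section Hecke

variable {B W : Type*} [Group W] {M : CoxeterMatrix B} (cs : CoxeterSystem M W)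
variable {k : Type*} [CommRing k] (q : k)

/-- The defining relations of the Hecke algebra, on the generators `e w` with `w` in `W`. -/
inductive HeckeRel : FreeAlgebra k W → FreeAlgebra k W → Prop
  | one : HeckeRel (FreeAlgebra.ι k 1) 1
  | quadratic (i : B) :
      HeckeRel ((FreeAlgebra.ι k (cs.simple i) + 1) *
        (FreeAlgebra.ι k (cs.simple i) - algebraMap k (FreeAlgebra k W) q)) 0
  | mul (w v : W) (h : cs.length (w * v) = cs.length w + cs.length v) :
      HeckeRel (FreeAlgebra.ι k w * FreeAlgebra.ι k v) (FreeAlgebra.ι k (w * v))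

/-- The Hecke algebra `H_q(W, S)` over `k`. -/
abbrev HeckeAlgebra : Type _ := RingQuot (HeckeRel cs q)

/-- The generator `e w` of the Hecke algebra. -/
def heckeGen (w : W) : HeckeAlgebra cs q :=
  RingQuot.mkAlgHom k (HeckeRel cs q) (FreeAlgebra.ι k w)

theorem finite_length_eq [Finite B] (D : Set W) (n : ℕ) :
    {w | w ∈ D ∧ cs.length w = n}.Finite := by
  refine ((List.finite_length_eq B n).image cs.wordProd).subset ?_
  rintro w ⟨-, hw⟩
  obtain ⟨ω, hω, rfl⟩ := cs.exists_isReduced w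
  exact ⟨ω, hω.symm.trans hw, rfl⟩

variable {q} {V : Type*} [AddCommGroup V] [Module k V]
variable (ρ : HeckeAlgebra cs q →ₐ[k] Module.End k V)

/-- The Poincaré series `D(ρ, u) = ∑ ρ(e w) u ^ ℓ(w)` (sum over `w` in `D`) twisted by `ρ`. -/
def poincareSeries [Finite B] (D : Set W) : PowerSeries (Module.End k V) :=
  PowerSeries.mk fun n => ∑ w ∈ (finite_length_eq cs D n).toFinset, ρ (heckeGen cs q w)

theorem constantCoeff_poincareSeries [Finite B] {D : Set W} (hD : 1 ∈ D) :
    PowerSeries.constantCoeff (poincareSeries cs ρ D) = 1 := by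
  have h : (finite_length_eq cs D 0).toFinset = {1} := by
    ext w
    simp only [Set.Finite.mem_toFinset, Set.mem_ofPred_eq, Finset.mem_singleton,
      cs.length_eq_zero_iff]
    exact ⟨fun h => h.2, fun h => ⟨h ▸ hD, h⟩⟩
  rw [← PowerSeries.coeff_zero_eq_constantCoeff_apply, poincareSeries, PowerSeries.coeff_mk, h,
    Finset.sum_singleton, heckeGen, RingQuot.mkAlgHom_rel k HeckeRel.one, map_one, map_one]

/-- The twisted Poincaré series of a set `D` containing the identity, as an invertible power
series. -/
def poincareUnit [Finite B] (D : Set W) (hD : 1 ∈ D) : (PowerSeries (Module.End k V))ˣ :=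
  (PowerSeries.isUnit_iff_constantCoeff.mpr
    (by rw [constantCoeff_poincareSeries cs ρ hD]; exact isUnit_one)).unit

theorem val_poincareUnit [Finite B] (D : Set W) (hD : 1 ∈ D) :
    (poincareUnit cs ρ D hD : PowerSeries (Module.End k V)) = poincareSeries cs ρ D := rfl

/-- The parabolic subgroup `W_I` generated by the simple reflections with index in `I`. -/
def parabolic (I : Finset B) : Subgroup W := Subgroup.closure (cs.simple '' I)

end Hecke

section Factors

variable {W : Type*} [Group W] {M : CoxeterMatrix (Fin 3)} (cs : CoxeterSystem M W)
variable {k : Type*} [CommRing k] {q : k} {V : Type*} [AddCommGroup V] [Module k V]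
variable (ρ : HeckeAlgebra cs q →ₐ[k] Module.End k V)

/-- The labels of the factors: `1, 2` (indices `0, 1`) for `H₁, H₂`, and the proper subsets `I` of
`S`. -/
abbrev FactorLabel : Type := Fin 2 ⊕ {I : Finset (Fin 3) // I ≠ Finset.univ}

/-- The factors `Hᵢ(ρ, u)`, where `Hᵢ` is the set of the powers `(w i) ^ n` with `n ≥ 0`, and
`W_I(ρ, u) ^ ((-1) ^ |I|)` for `I` a proper subset of `S`. -/
def factor (w : Fin 2 → W) : FactorLabel → (PowerSeries (Module.End k V))ˣ
  | .inl i => poincareUnit cs ρ (Submonoid.powers (w i)) (one_mem _)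
  | .inr I => poincareUnit cs ρ (parabolic cs I.1) (one_mem _) ^ ((-1 : ℤ) ^ I.1.card)

end Factors

end

/-! Write x, y, z for ρ(e_s)u with s = s₁, s₂, s₃. The group W is infinite, so no element has all
three simple reflections as right descents (`exists_not_isRightDescent`). Inclusion-exclusion over
descent sets then shows that the alternating sum, over proper I, of the series of the minimal
representatives W^I of the cosets wW_I is 1 (`poincareSeries_minimalCosetReps_alternating`). As
W^I(ρ,u) W_I(ρ,u) = W(ρ,u), the element m = ∑ (-1)^|I| W_I(ρ,u)⁻¹ is a right inverse of W(ρ,u).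

Each W_I(ρ,u) is a polynomial in x, y, z, given by reduced words. Multiplying m by the series of
{s₁, s₃} on the left and that of {s₁, s₂} on the right removes most inverses, and the braid
relations factor the result into terms 1 - (word for wᵢ) and parabolic factors (`eq_prod_A2`,
`eq_prod_C2`, `eq_prod_G2`). Inverting gives the ordered product, because Hᵢ(ρ,u) is the geometric
series of wᵢ; this needs ℓ(wᵢⁿ) = nℓ(wᵢ) (`length_pow_mul_of_isStraightWord`).

Lengths are read off from the action on the affine root lattice: wsᵢ is longer than w exactly if wαᵢ
≥ 0 (`isRightDescent_iff_rootRep_nonneg`). Statements about particular words thus become finite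
computations with integer vectors.

To identify wᵢ, lattice elements are viewed as affine functions on the plane, with δ the constant 1.
The strip g𝒯ᵢ is 0 < gα < 1, where α is the simple root constant along vᵢ (`strip_eq`). After
conjugation by g, a stabilizing element that translates the middle line fixes α or replaces it by δ
- α, and it maps a vector τ orthogonal to α to τ - yδ, with y proportional to the translation
length. The invariance of δ and congruences mod 2 and 3 bound a positive y from below. An explicit
word attains the bound, and at the bound the images of α, τ, δ, hence the element, are determined
(`isStripGenerator_iff`). -/

noncomputable section

/-! ### The affine root lattice -/

namespace AffineType

/-- The Cartan matrix `A` of the (untwisted) affine root system: the reflection in the simple root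
`αᵢ` maps `αⱼ` to `αⱼ - A i j • αᵢ`. -/
def cartan : AffineType → Fin 3 → Fin 3 → ℤ
  | A2 => ![![2, -1, -1], ![-1, 2, -1], ![-1, -1, 2]]
  | C2 => ![![2, -2, -2], ![-1, 2, 0], ![-1, 0, 2]]
  | G2 => ![![2, -1, -1], ![-3, 2, 0], ![-1, 0, 2]]

/-- The reflection in the simple root `αᵢ`, acting on the root lattice. -/
def reflectRoot (t : AffineType) (i : Fin 3) (p : Fin 3 → ℤ) : Fin 3 → ℤ :=
  let c := t.cartan i 0 * p 0 + t.cartan i 1 * p 1 + t.cartan i 2 * p 2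
  match i with
  | 0 => ![p 0 - c, p 1, p 2]
  | 1 => ![p 0, p 1 - c, p 2]
  | 2 => ![p 0, p 1, p 2 - c]

theorem reflectRoot_apply (t : AffineType) (i : Fin 3) (p : Fin 3 → ℤ) (k : Fin 3) :
    t.reflectRoot i p k = p k - if k = i then
      t.cartan i 0 * p 0 + t.cartan i 1 * p 1 + t.cartan i 2 * p 2 else 0 := by
  fin_cases i <;> fin_cases k <;> simp [reflectRoot]

/-- The simple root `αᵢ`. -/
abbrev simpleRoot (i : Fin 3) : Fin 3 → ℤ := Pi.single i 1

/-- The reflection in the simple root `αᵢ`, as an endomorphism of the root lattice. -/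
def reflectRootHom (t : AffineType) (i : Fin 3) : Module.End ℤ (Fin 3 → ℤ) where
  toFun := t.reflectRoot i
  map_add' p q := by
    ext k
    simp only [reflectRoot_apply, Pi.add_apply]
    split_ifs <;> ring
  map_smul' c p := by
    ext k
    simp only [reflectRoot_apply, Pi.smul_apply, smul_eq_mul, RingHom.id_apply]
    split_ifs <;> ring

@[simp] theorem reflectRootHom_apply (t : AffineType) (i : Fin 3) (p : Fin 3 → ℤ) :
    t.reflectRootHom i p = t.reflectRoot i p := rfl

/-- It suffices to test the braid relations on the basis of simple roots, which is a finite
computation. -/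
theorem isLiftable_reflectRootHom (t : AffineType) :
    t.coxeterMatrix.IsLiftable t.reflectRootHom := by
  have key : ∀ i j k l : Fin 3, ((List.replicate (t.coxeterMatrix i j) [i, j]).flatten.foldr
      t.reflectRoot (simpleRoot k)) l = simpleRoot k l := by
    cases t <;> decide +kernel
  have hpow : ∀ (i j : Fin 3) (n : ℕ) (p : Fin 3 → ℤ),
      ((t.reflectRootHom i * t.reflectRootHom j) ^ n) p
        = (List.replicate n [i, j]).flatten.foldr t.reflectRoot p := by
    intro i j n p
    induction n with
    | zero => simp
    | succ n ih => rw [pow_succ', List.replicate_succ, Module.End.mul_apply, ih]; simp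
  intro i j
  refine (Pi.basisFun ℤ (Fin 3)).ext fun k => ?_
  rw [hpow, Pi.basisFun_apply]
  ext l
  exact key i j k l

end AffineType

open AffineType

/-! ### Descents and the signs of roots -/

section RootRepresentation

variable {W : Type*} [Group W] {t : AffineType} (cs : CoxeterSystem t.coxeterMatrix W)

/-- The action of `W` on the root lattice. -/
def rootRep : W →* Module.End ℤ (Fin 3 → ℤ) :=
  cs.lift ⟨t.reflectRootHom, t.isLiftable_reflectRootHom⟩

@[simp] theorem rootRep_simple (i : Fin 3) (p : Fin 3 → ℤ) :
    rootRep cs (cs.simple i) p = t.reflectRoot i p := by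
  rw [rootRep, cs.lift_apply_simple]; rfl

theorem rootRep_mul (w v : W) (p : Fin 3 → ℤ) :
    rootRep cs (w * v) p = rootRep cs w (rootRep cs v p) := by
  rw [map_mul]; rfl

theorem rootRep_one (p : Fin 3 → ℤ) : rootRep cs 1 p = p := by
  rw [map_one]; rfl

theorem rootRep_wordProd (ω : List (Fin 3)) (p : Fin 3 → ℤ) :
    rootRep cs (cs.wordProd ω) p = ω.foldr t.reflectRoot p := by
  induction ω with
  | nil => rw [cs.wordProd_nil, rootRep_one]; rfl
  | cons i ω ih => rw [cs.wordProd_cons, rootRep_mul, ih, rootRep_simple]; rfl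

theorem rootRep_inv_cancel (w : W) (p : Fin 3 → ℤ) : rootRep cs w⁻¹ (rootRep cs w p) = p := by
  rw [← rootRep_mul, inv_mul_cancel, rootRep_one]

theorem rootRep_cancel_inv (w : W) (p : Fin 3 → ℤ) : rootRep cs w (rootRep cs w⁻¹ p) = p := by
  rw [← rootRep_mul, mul_inv_cancel, rootRep_one]

theorem rootRep_injective (w : W) : Function.Injective (rootRep cs w) :=
  Function.LeftInverse.injective (rootRep_inv_cancel cs w)

theorem rootRep_ne_zero (w : W) {p : Fin 3 → ℤ} (hp : p ≠ 0) : rootRep cs w p ≠ 0 := fun h =>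
  hp (rootRep_injective cs w (h.trans (map_zero _).symm))

theorem simpleRoot_ne_zero (i : Fin 3) : simpleRoot i ≠ 0 := by
  simp

theorem eq_sum_simpleRoot (p : Fin 3 → ℤ) : p = ∑ i, p i • simpleRoot i := by
  ext k
  simp [Finset.sum_apply, Pi.single_apply]

theorem rootRep_apply_eq_sum (w : W) (p : Fin 3 → ℤ) :
    rootRep cs w p = ∑ i, p i • rootRep cs w (simpleRoot i) := by
  conv_lhs => rw [eq_sum_simpleRoot p]
  simp only [map_sum, map_smul]

theorem rootRep_nonneg_of_forall (w : W) {p : Fin 3 → ℤ} (hp : 0 ≤ p)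
    (h : ∀ i, p i ≠ 0 → 0 ≤ rootRep cs w (simpleRoot i)) : 0 ≤ rootRep cs w p := by
  rw [rootRep_apply_eq_sum]
  refine Finset.sum_nonneg fun i _ => ?_
  by_cases hi : p i = 0
  · rw [hi, zero_smul]
  · exact smul_nonneg (hp i) (h i hi)

/-- The rank two case of the positivity of roots, checked by computation: an alternating word ending
in j and shorter than the braid word keeps αᵢ positive, in the span of αᵢ and αⱼ. -/
theorem AffineType.alternatingWord_simpleRoot_nonneg (t : AffineType) :
    ∀ i j : Fin 3, i ≠ j → ∀ k : Fin (t.coxeterMatrix i j), ∀ l : Fin 3,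
      0 ≤ (CoxeterSystem.alternatingWord i j k).foldr t.reflectRoot (simpleRoot i) l ∧
      (l ≠ i → l ≠ j →
        (CoxeterSystem.alternatingWord i j k).foldr t.reflectRoot (simpleRoot i) l = 0) := by
  cases t <;> intro i j <;> fin_cases i <;> fin_cases j <;> decide +kernel

/-- If `w sᵢ` is longer than `w`, then `w` maps the simple root `αᵢ` to a positive root. -/
theorem rootRep_simpleRoot_nonneg (w : W) (i : Fin 3) (h : ¬ cs.IsRightDescent w i) :
    0 ≤ rootRep cs w (simpleRoot i) := by
  induction hn : cs.length w using Nat.strong_induction_on generalizing w i with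
  | _ n ih =>
  subst hn
  by_cases hw : w = 1
  · subst hw
    rw [rootRep_one]
    exact Pi.single_nonneg.mpr zero_le_one
  obtain ⟨j, hj⟩ := cs.exists_rightDescent_of_ne_one hw
  have hij : i ≠ j := fun e => h (e ▸ hj)
  -- Split off from w the longest possible suffix that alternates in i, j and ends in j, with
  -- lengths adding.
  let P : ℕ → Prop := fun k => ∃ v, w = v * cs.wordProd (CoxeterSystem.alternatingWord i j k) ∧
    cs.length w = cs.length v + k
  have hP1 : P 1 := by
    refine ⟨w * cs.simple j, ?_, ?_⟩
    · simp [CoxeterSystem.alternatingWord]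
    · exact (cs.isRightDescent_iff.mp hj).symm
  have hm : 1 ≤ t.coxeterMatrix i j := by
    have : ∀ i j, 1 ≤ t.coxeterMatrix i j := by
      cases t <;> intro i j <;> fin_cases i <;> fin_cases j <;> decide
    exact this i j
  classical
  set m := t.coxeterMatrix i j with hmdef
  set k := Nat.findGreatest P m with hk
  have hk1 : 1 ≤ k := Nat.le_findGreatest hm hP1
  obtain ⟨v, hv, hlen⟩ : P k := Nat.findGreatest_spec hm hP1
  -- A full braid word could be rewritten to end in i, making i a right descent of w.
  have hkm : k < m := by
    refine lt_of_le_of_ne (Nat.findGreatest_le m) fun e => h ?_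
    have hbraid := cs.wordProd_braidWord_eq i j
    unfold CoxeterSystem.braidWord at hbraid
    rw [t.coxeterMatrix.symmetric j i, ← hmdef] at hbraid
    obtain ⟨m', hm'⟩ : ∃ m', m = m' + 1 := ⟨m - 1, by omega⟩
    rw [e, hbraid, hm', CoxeterSystem.alternatingWord_succ, cs.wordProd_concat] at hv
    have hws : w * cs.simple i = v * cs.wordProd (CoxeterSystem.alternatingWord i j m') := by
      rw [hv, mul_assoc, mul_assoc, cs.simple_mul_simple_self, mul_one]
    have h1 := cs.length_mul_le v (cs.wordProd (CoxeterSystem.alternatingWord i j m'))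
    have h2 := cs.length_wordProd_le (CoxeterSystem.alternatingWord i j m')
    rw [CoxeterSystem.length_alternatingWord] at h2
    unfold CoxeterSystem.IsRightDescent
    rw [hws]
    omega
  obtain ⟨k', hk'⟩ : ∃ k', k = k' + 1 := ⟨k - 1, by omega⟩
  -- This letter would prolong the alternating suffix, against maximality.
  have hnext : ¬ cs.IsRightDescent v (if Even k then j else i) := by
    intro hd
    refine Nat.findGreatest_is_greatest (P := P) (n := m) (k := k + 1) (by omega) (by omega) ?_
    refine ⟨v * cs.simple (if Even k then j else i), ?_, ?_⟩
    · rw [CoxeterSystem.alternatingWord_succ', cs.wordProd_cons, mul_assoc,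
        cs.simple_mul_simple_cancel_left]
      exact hv
    · have := cs.isRightDescent_iff.mp hd
      omega
  -- This is the first letter of the suffix; if v could end in it, the two letters would cancel and
  -- w would be too short.
  have hprev : ¬ cs.IsRightDescent v (if Even k' then j else i) := by
    intro hd
    have hd' := cs.isRightDescent_iff.mp hd
    rw [hk', CoxeterSystem.alternatingWord_succ', cs.wordProd_cons, ← mul_assoc] at hv
    have h1 := cs.length_mul_le (v * cs.simple (if Even k' then j else i))
      (cs.wordProd (CoxeterSystem.alternatingWord i j k'))
    have h2 := cs.length_wordProd_le (CoxeterSystem.alternatingWord i j k')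
    rw [CoxeterSystem.length_alternatingWord] at h2
    rw [← hv] at h1
    omega
  have hboth : ¬ cs.IsRightDescent v i ∧ ¬ cs.IsRightDescent v j := by
    rcases Nat.even_or_odd k' with he | ho
    · have ho : ¬ Even k := by rw [hk', Nat.even_add_one]; simpa using he
      rw [if_neg ho] at hnext
      rw [if_pos he] at hprev
      exact ⟨hnext, hprev⟩
    · have ho' : ¬ Even k' := by simpa using ho
      have he : Even k := by rw [hk', Nat.even_add_one]; exact ho'
      rw [if_pos he] at hnext
      rw [if_neg ho'] at hprev
      exact ⟨hprev, hnext⟩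
  have hlt : cs.length v < cs.length w := by omega
  have hpos := t.alternatingWord_simpleRoot_nonneg i j hij ⟨k, hkm⟩
  rw [hv, rootRep_mul, rootRep_wordProd]
  refine rootRep_nonneg_of_forall cs v (fun l => (hpos l).1) fun l hl => ?_
  by_cases hli : l = i
  · subst hli; exact ih _ hlt v l hboth.1 rfl
  by_cases hlj : l = j
  · subst hlj; exact ih _ hlt v l hboth.2 rfl
  exact absurd ((hpos l).2 hli hlj) hl

theorem reflectRoot_simpleRoot (t : AffineType) (i : Fin 3) :
    t.reflectRoot i (simpleRoot i) = - simpleRoot i := by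
  have : ∀ i l, t.reflectRoot i (simpleRoot i) l = - simpleRoot i l := by
    cases t <;> decide
  exact funext (this i)

theorem rootRep_simpleRoot_nonpos (w : W) (i : Fin 3) (h : cs.IsRightDescent w i) :
    rootRep cs w (simpleRoot i) ≤ 0 := by
  have := rootRep_simpleRoot_nonneg cs (w * cs.simple i) i
    (cs.isRightDescent_iff_not_isRightDescent_mul.mp h)
  rw [rootRep_mul, rootRep_simple, reflectRoot_simpleRoot, map_neg] at this
  exact neg_nonneg.mp this

/-- The image of a simple root is nonzero, so it cannot be both nonnegative and nonpositive. -/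
theorem isRightDescent_iff_rootRep_nonneg (w : W) (i : Fin 3) :
    ¬ cs.IsRightDescent w i ↔ 0 ≤ rootRep cs w (simpleRoot i) := by
  refine ⟨rootRep_simpleRoot_nonneg cs w i, fun h hd => ?_⟩
  exact rootRep_ne_zero cs w (simpleRoot_ne_zero i)
    (le_antisymm (rootRep_simpleRoot_nonpos cs w i hd) h)

theorem length_mul_simple_of_nonneg (w : W) (i : Fin 3) (h : 0 ≤ rootRep cs w (simpleRoot i)) :
    cs.length (w * cs.simple i) = cs.length w + 1 :=
  cs.not_isRightDescent_iff.mp ((isRightDescent_iff_rootRep_nonneg cs w i).mpr h)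

/-- The action on the root lattice is faithful. -/
theorem eq_one_of_rootRep_simpleRoot (w : W)
    (h : ∀ i, rootRep cs w (simpleRoot i) = simpleRoot i) : w = 1 := by
  by_contra hw
  obtain ⟨i, hi⟩ := cs.exists_rightDescent_of_ne_one hw
  refine (isRightDescent_iff_rootRep_nonneg cs w i).mpr ?_ hi
  rw [h]
  exact Pi.single_nonneg.mpr zero_le_one

theorem eq_of_rootRep_simpleRoot {w v : W}
    (h : ∀ i, rootRep cs w (simpleRoot i) = rootRep cs v (simpleRoot i)) : w = v := by
  refine inv_mul_eq_one.mp (eq_one_of_rootRep_simpleRoot cs (w⁻¹ * v) fun i => ?_)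
  rw [rootRep_mul, ← h, rootRep_inv_cancel]

/-- The basic imaginary root `δ`. -/
def AffineType.delta : AffineType → Fin 3 → ℤ
  | A2 => ![1, 1, 1]
  | C2 => ![2, 1, 1]
  | G2 => ![2, 3, 1]

@[simp] theorem rootRep_delta (w : W) : rootRep cs w t.delta = t.delta := by
  have key : ∀ i l, t.reflectRoot i t.delta l = t.delta l := by cases t <;> decide
  induction w using cs.simple_induction_left with
  | one => rw [rootRep_one]
  | mul_simple_left w i ih => rw [rootRep_mul, ih, rootRep_simple]; exact funext (key i)

theorem AffineType.delta_pos (t : AffineType) : ∀ i, 0 < t.delta i := by cases t <;> decide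

/-- No element of `W` has all simple reflections as right descents. -/
theorem exists_not_isRightDescent (w : W) : ∃ i, ¬ cs.IsRightDescent w i := by
  by_contra! h
  -- All coefficients of δ are positive, so wδ would be nonpositive, although wδ = δ.
  have h1 : rootRep cs w t.delta ≤ 0 := by
    rw [rootRep_apply_eq_sum]
    exact Finset.sum_nonpos fun i _ =>
      smul_nonpos_of_nonneg_of_nonpos (t.delta_pos i).le (rootRep_simpleRoot_nonpos cs w i (h i))
  rw [rootRep_delta] at h1
  exact absurd (h1 0) (not_le.mpr (t.delta_pos 0))

end RootRepresentation

/-! ### Twisted Poincaré series of subsets -/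

section PoincareSeries

variable {B W : Type*} [Group W] {M : CoxeterMatrix B} (cs : CoxeterSystem M W)
variable {k : Type*} [CommRing k] {q : k} {V : Type*} [AddCommGroup V] [Module k V]
variable (ρ : HeckeAlgebra cs q →ₐ[k] Module.End k V)

theorem heckeGen_mul {w v : W} (h : cs.length (w * v) = cs.length w + cs.length v) :
    heckeGen cs q (w * v) = heckeGen cs q w * heckeGen cs q v := by
  rw [heckeGen, ← RingQuot.mkAlgHom_rel k (HeckeRel.mul w v h), map_mul]
  rfl

theorem heckeGen_one : heckeGen cs q 1 = 1 := by
  rw [heckeGen, RingQuot.mkAlgHom_rel k HeckeRel.one, map_one]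

/-- The term `ρ(e w) u ^ ℓ(w)` of the twisted Poincaré series. -/
def poincareTerm (w : W) : PowerSeries (Module.End k V) :=
  PowerSeries.monomial (cs.length w) (ρ (heckeGen cs q w))

theorem poincareTerm_one : poincareTerm cs ρ 1 = 1 := by
  rw [poincareTerm, cs.length_one, heckeGen_one, map_one, PowerSeries.monomial_zero_eq_C_apply,
    map_one]

theorem poincareTerm_mul {w v : W} (h : cs.length (w * v) = cs.length w + cs.length v) :
    poincareTerm cs ρ (w * v) = poincareTerm cs ρ w * poincareTerm cs ρ v := by
  rw [poincareTerm, poincareTerm, poincareTerm, PowerSeries.monomial_mul_monomial, h,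
    heckeGen_mul cs h, map_mul]

theorem poincareTerm_wordProd {ω : List B} (h : cs.IsReduced ω) :
    poincareTerm cs ρ (cs.wordProd ω) = (ω.map fun i => poincareTerm cs ρ (cs.simple i)).prod := by
  induction ω with
  | nil => rw [cs.wordProd_nil, poincareTerm_one]; rfl
  | cons i ω ih =>
    have h' : cs.IsReduced ω := by simpa using h.drop 1
    rw [cs.wordProd_cons, poincareTerm_mul, ih h']
    · rfl
    · rw [← cs.wordProd_cons, h.eq, h'.eq, cs.length_simple, List.length_cons, add_comm]

variable [Finite B]

-- With a summation range independent of D, linear relations between series of sets can be checked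
-- at each group element separately.
open Classical in
theorem coeff_poincareSeries (D : Set W) (n : ℕ) :
    PowerSeries.coeff n (poincareSeries cs ρ D) =
      ∑ w ∈ (finite_length_eq cs Set.univ n).toFinset,
        if w ∈ D then ρ (heckeGen cs q w) else 0 := by
  rw [poincareSeries, PowerSeries.coeff_mk, ← Finset.sum_filter]
  congr 1
  ext w
  simp [and_comm]

theorem poincareSeries_union {D E : Set W} (h : Disjoint D E) :
    poincareSeries cs ρ (D ∪ E) = poincareSeries cs ρ D + poincareSeries cs ρ E := by
  classical
  ext1 n
  rw [map_add]
  simp only [coeff_poincareSeries]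
  rw [← Finset.sum_add_distrib]
  refine Finset.sum_congr rfl fun w _ => ?_
  by_cases hD : w ∈ D
  · simp [hD, Set.disjoint_left.mp h hD]
  · simp [hD]

theorem poincareSeries_singleton (w : W) :
    poincareSeries cs ρ {w} = poincareTerm cs ρ w := by
  classical
  ext1 n
  rw [coeff_poincareSeries, poincareTerm, PowerSeries.coeff_monomial]
  simp only [Set.mem_singleton_iff, Finset.sum_ite_eq', Set.Finite.mem_toFinset]
  simp [eq_comm]

theorem poincareSeries_empty : poincareSeries cs ρ ∅ = 0 := by
  ext1 n
  rw [coeff_poincareSeries]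
  simp

/-- Additivity of lengths makes w ↦ ρ(e_w)u^ℓ(w) multiplicative on D × E, so the Cauchy product is
the sum over F. -/
theorem poincareSeries_mul {D E F : Set W}
    (hadd : ∀ w ∈ D, ∀ v ∈ E, cs.length (w * v) = cs.length w + cs.length v)
    (hbij : Set.BijOn (fun p : W × W => p.1 * p.2) (D ×ˢ E) F) :
    poincareSeries cs ρ D * poincareSeries cs ρ E = poincareSeries cs ρ F := by
  ext1 n
  rw [PowerSeries.coeff_mul]
  simp only [poincareSeries, PowerSeries.coeff_mk, Finset.sum_mul_sum, ← Finset.sum_product']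
  rw [Finset.sum_sigma']
  refine Finset.sum_bij (fun s _ => s.2.1 * s.2.2) ?_ ?_ ?_ ?_
  · rintro ⟨⟨a, b⟩, w, v⟩ h
    simp only [Finset.mem_sigma, Finset.HasAntidiagonal.mem_antidiagonal, Finset.mem_product,
      Set.Finite.mem_toFinset, Set.mem_ofPred_eq] at h ⊢
    obtain ⟨hab, ⟨hw, hwl⟩, hv, hvl⟩ := h
    exact ⟨hbij.mapsTo (Set.mk_mem_prod hw hv), by rw [hadd w hw v hv, hwl, hvl, hab]⟩
  · rintro ⟨⟨a, b⟩, w, v⟩ h ⟨⟨a', b'⟩, w', v'⟩ h' e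
    simp only [Finset.mem_sigma, Finset.HasAntidiagonal.mem_antidiagonal, Finset.mem_product,
      Set.Finite.mem_toFinset, Set.mem_ofPred_eq] at h h' e
    have := hbij.injOn (Set.mk_mem_prod h.2.1.1 h.2.2.1) (Set.mk_mem_prod h'.2.1.1 h'.2.2.1) e
    obtain ⟨rfl, rfl⟩ := Prod.mk.inj this
    obtain rfl := h.2.1.2.symm.trans h'.2.1.2
    obtain rfl := h.2.2.2.symm.trans h'.2.2.2
    rfl
  · intro x hx
    simp only [Set.Finite.mem_toFinset, Set.mem_ofPred_eq] at hx
    obtain ⟨⟨w, v⟩, ⟨hw, hv⟩, rfl⟩ := hbij.surjOn hx.1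
    refine ⟨⟨⟨cs.length w, cs.length v⟩, w, v⟩, ?_, rfl⟩
    simp only [Finset.mem_sigma, Finset.HasAntidiagonal.mem_antidiagonal, Finset.mem_product,
      Set.Finite.mem_toFinset, Set.mem_ofPred_eq]
    exact ⟨(hadd w hw v hv).symm.trans hx.2, ⟨hw, trivial⟩, hv, trivial⟩
  · rintro ⟨⟨a, b⟩, w, v⟩ h
    simp only [Finset.mem_sigma, Finset.HasAntidiagonal.mem_antidiagonal, Finset.mem_product,
      Set.Finite.mem_toFinset, Set.mem_ofPred_eq] at h
    simp only
    rw [heckeGen_mul cs (hadd w h.2.1.1 v h.2.2.1), map_mul]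

/-- The twisted Poincaré series of a finite set that is given by a list of reduced words. -/
theorem poincareSeries_list {L : List (List B)} (hred : ∀ ω ∈ L, cs.IsReduced ω)
    (hnodup : (L.map cs.wordProd).Nodup) :
    poincareSeries cs ρ {w | w ∈ L.map cs.wordProd} =
      (L.map fun ω => (ω.map fun i => poincareTerm cs ρ (cs.simple i)).prod).sum := by
  induction L with
  | nil => simp [poincareSeries_empty]
  | cons ω L ih =>
    have hset : {w | w ∈ (ω :: L).map cs.wordProd} =
        {cs.wordProd ω} ∪ {w | w ∈ L.map cs.wordProd} := by
      ext w; simp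
    rw [List.map_cons, List.nodup_cons] at hnodup
    rw [hset, poincareSeries_union, poincareSeries_singleton,
      ih (fun ω' h => hred ω' (List.mem_cons_of_mem _ h)) hnodup.2,
      poincareTerm_wordProd cs ρ (hred ω List.mem_cons_self), List.map_cons, List.sum_cons]
    rw [Set.disjoint_singleton_left]
    exact hnodup.1

/-- If the lengths of the powers of `w` are additive, then the twisted Poincaré series of the set
of powers of `w` is a geometric series. -/
theorem poincareSeries_powers_mul {w : W} (hw : w ≠ 1)
    (h : ∀ n : ℕ, cs.length (w ^ n * w) = cs.length (w ^ n) + cs.length w) :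
    poincareSeries cs ρ (Submonoid.powers w) * (1 - poincareTerm cs ρ w) = 1 := by
  have hlen : ∀ n : ℕ, cs.length (w ^ n) = n * cs.length w := by
    intro n
    induction n with
    | zero => simp
    | succ n ih => rw [pow_succ, h, ih, Nat.succ_mul]
  have hpos : cs.length w ≠ 0 := fun h0 => hw (cs.length_eq_zero_iff.mp h0)
  have h1 : poincareSeries cs ρ (Submonoid.powers w) * poincareSeries cs ρ {w} =
      poincareSeries cs ρ ((fun v => v * w) '' (Submonoid.powers w : Set W)) := by
    refine poincareSeries_mul cs ρ ?_ ⟨?_, ?_, ?_⟩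
    · rintro _ ⟨n, rfl⟩ v rfl
      exact h n
    · rintro ⟨a, b⟩ ⟨ha, rfl⟩
      exact ⟨a, ha, rfl⟩
    · rintro ⟨a, b⟩ ⟨ha, rfl⟩ ⟨a', b'⟩ ⟨ha', hb'⟩ e
      obtain rfl : b' = b := hb'
      exact Prod.ext (mul_right_cancel e) rfl
    · rintro _ ⟨a, ha, rfl⟩
      exact ⟨(a, w), ⟨ha, rfl⟩, rfl⟩
  -- The powers are 1 together with w times the powers; additivity of lengths makes this union
  -- disjoint.
  have h2 : (Submonoid.powers w : Set W) = {1} ∪ (fun v => v * w) '' (Submonoid.powers w : Set W) := by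
    ext v
    constructor
    · rintro ⟨n, rfl⟩
      cases n with
      | zero => left; simp
      | succ n => exact Or.inr ⟨w ^ n, ⟨n, rfl⟩, (pow_succ w n).symm⟩
    · rintro (rfl | ⟨_, ⟨n, rfl⟩, rfl⟩)
      · exact one_mem _
      · exact ⟨n + 1, pow_succ w n⟩
  have h3 : poincareSeries cs ρ (Submonoid.powers w) = 1 + poincareSeries cs ρ
      ((fun v => v * w) '' (Submonoid.powers w : Set W)) := by
    conv_lhs => rw [h2]
    rw [poincareSeries_union, poincareSeries_singleton, poincareTerm_one]
    rw [Set.disjoint_singleton_left]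
    rintro ⟨_, ⟨n, rfl⟩, e⟩
    have := hlen (n + 1)
    rw [pow_succ] at this
    simp only at e
    rw [e, cs.length_one] at this
    rcases Nat.mul_eq_zero.mp this.symm with h' | h'
    · omega
    · exact hpos h'
  rw [mul_sub, mul_one, ← poincareSeries_singleton, h1, h3, add_sub_cancel_right]

end PoincareSeries

/-! ### Parabolic subgroups and minimal coset representatives -/

section Parabolic

variable {W : Type*} [Group W] {t : AffineType} (cs : CoxeterSystem t.coxeterMatrix W)

theorem rootRep_simple_apply_of_ne (i : Fin 3) (p : Fin 3 → ℤ) {j : Fin 3} (h : j ≠ i) :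
    rootRep cs (cs.simple i) p j = p j := by
  rw [rootRep_simple, reflectRoot_apply, if_neg h, sub_zero]

theorem rootRep_apply_of_mem_parabolic {I : Finset (Fin 3)} {v : W} (hv : v ∈ parabolic cs I)
    (p : Fin 3 → ℤ) {j : Fin 3} (hj : j ∉ I) : rootRep cs v p j = p j := by
  induction hv using Subgroup.closure_induction_left with
  | one => rw [rootRep_one]
  | mul_left x hx y hy ih =>
    obtain ⟨i, hi, rfl⟩ := hx
    rw [rootRep_mul, rootRep_simple_apply_of_ne cs i _ (by rintro rfl; exact hj hi), ih]
  | inv_mul_cancel x hx y hy ih =>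
    obtain ⟨i, hi, rfl⟩ := hx
    rw [cs.inv_simple, rootRep_mul, rootRep_simple_apply_of_ne cs i _ (by rintro rfl; exact hj hi), ih]

theorem simple_mem_parabolic {I : Finset (Fin 3)} {i : Fin 3} (h : i ∈ I) :
    cs.simple i ∈ parabolic cs I :=
  Subgroup.subset_closure ⟨i, h, rfl⟩

/-- The set `W^I` of the minimal representatives of the cosets `w W_I`. -/
def minimalCosetReps (I : Finset (Fin 3)) : Set W := {w | ∀ i ∈ I, ¬ cs.IsRightDescent w i}

/-- Induct on ℓ(v), removing a right descent j. The positive root (v sⱼ)αⱼ is a combination of the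
αᵢ with i in I, and w keeps these positive; hence multiplying w v sⱼ by sⱼ increases the length. -/
theorem length_mul_of_mem_minimalCosetReps {I : Finset (Fin 3)} {w v : W}
    (hw : w ∈ minimalCosetReps cs I) (hv : v ∈ parabolic cs I) :
    cs.length (w * v) = cs.length w + cs.length v := by
  induction hn : cs.length v generalizing v with
  | zero => rw [cs.length_eq_zero_iff] at hn; rw [hn, mul_one, add_zero]
  | succ n ih =>
    have hv1 : v ≠ 1 := by rintro rfl; simp at hn
    obtain ⟨j, hj⟩ := cs.exists_rightDescent_of_ne_one hv1
    have hjI : j ∈ I := by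
      -- An element of W_I leaves the coordinates outside I unchanged, so the j-th coordinate of vαⱼ
      -- would still be 1.
      by_contra hjI
      have h1 := rootRep_simpleRoot_nonpos cs v j hj j
      rw [rootRep_apply_of_mem_parabolic cs hv _ hjI] at h1
      simp at h1
    have hl := cs.isRightDescent_iff.mp hj
    have hv' : v * cs.simple j ∈ parabolic cs I := mul_mem hv (simple_mem_parabolic cs hjI)
    have h2 := ih hv' (by omega)
    have h3 : 0 ≤ rootRep cs (w * (v * cs.simple j)) (simpleRoot j) := by
      rw [rootRep_mul]
      refine rootRep_nonneg_of_forall cs w (rootRep_simpleRoot_nonneg cs _ j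
        (cs.isRightDescent_iff_not_isRightDescent_mul.mp hj)) fun i hi => ?_
      refine rootRep_simpleRoot_nonneg cs w i (hw i ?_)
      by_contra hiI
      rw [rootRep_apply_of_mem_parabolic cs hv' _ hiI] at hi
      refine hi (Pi.single_eq_of_ne ?_ _)
      rintro rfl
      exact hiI hjI
    have h4 := length_mul_simple_of_nonneg cs _ j h3
    rw [mul_assoc, cs.simple_mul_simple_cancel_right] at h4
    omega

/-- If two representatives differ by an element of W_I, additivity of lengths in both directions
forces it to have length 0. Existence follows by stripping off right descents in I. -/
theorem bijOn_minimalCosetReps_mul_parabolic (I : Finset (Fin 3)) :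
    Set.BijOn (fun p : W × W => p.1 * p.2) (minimalCosetReps cs I ×ˢ (parabolic cs I : Set W))
      Set.univ := by
  refine ⟨fun _ _ => Set.mem_univ _, ?_, ?_⟩
  · rintro ⟨w, v⟩ ⟨hw, hv⟩ ⟨w', v'⟩ ⟨hw', hv'⟩ e
    simp only at e hw hv hw' hv'
    have e1 : w = w' * (v' * v⁻¹) := by rw [← mul_assoc, ← e, mul_inv_cancel_right]
    have e2 : w' = w * (v' * v⁻¹)⁻¹ := by rw [e1, mul_inv_cancel_right]
    have hm : v' * v⁻¹ ∈ parabolic cs I := mul_mem hv' (inv_mem hv)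
    have h1 := length_mul_of_mem_minimalCosetReps cs hw' hm
    have h2 := length_mul_of_mem_minimalCosetReps cs hw (inv_mem hm)
    rw [← e1] at h1
    rw [← e2] at h2
    have h3 : v' * v⁻¹ = 1 := cs.length_eq_zero_iff.mp (by omega)
    rw [h3, mul_one] at e1
    exact Prod.ext e1 (mul_inv_eq_one.mp h3).symm
  · intro w _
    induction hn : cs.length w using Nat.strong_induction_on generalizing w with
    | _ n ih =>
    by_cases hw : w ∈ minimalCosetReps cs I
    · exact ⟨(w, 1), ⟨hw, one_mem _⟩, mul_one w⟩
    · simp only [minimalCosetReps, Set.mem_ofPred_eq, not_forall, not_not] at hw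
      obtain ⟨i, hi, hd⟩ := hw
      have := cs.isRightDescent_iff.mp hd
      obtain ⟨⟨a, b⟩, ⟨ha, hb⟩, e⟩ := ih _ (by omega) (Set.mem_univ (w * cs.simple i)) rfl
      refine ⟨(a, b * cs.simple i), ⟨ha, mul_mem hb (simple_mem_parabolic cs hi)⟩, ?_⟩
      simp only at e ⊢
      rw [← mul_assoc, e, cs.simple_mul_simple_cancel_right]

variable {k : Type*} [CommRing k] {q : k} {V : Type*} [AddCommGroup V] [Module k V]
variable (ρ : HeckeAlgebra cs q →ₐ[k] Module.End k V)

theorem poincareSeries_minimalCosetReps_mul (I : Finset (Fin 3)) :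
    poincareSeries cs ρ (minimalCosetReps cs I) * poincareSeries cs ρ (parabolic cs I) =
      poincareSeries cs ρ Set.univ :=
  poincareSeries_mul cs ρ (fun _ hw _ hv => length_mul_of_mem_minimalCosetReps cs hw hv)
    (bijOn_minimalCosetReps_mul_parabolic cs I)

/-- An element w lies in W^I exactly if I is contained in its set A of right ascents. The
alternating count of proper subsets I of A is 0 if A is nonempty and proper, and 1 if A = S, that
is, w = 1. The case of empty A does not occur. -/
theorem poincareSeries_minimalCosetReps_alternating :
    poincareSeries cs ρ Set.univ - poincareSeries cs ρ (minimalCosetReps cs {0})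
      - poincareSeries cs ρ (minimalCosetReps cs {1})
      - poincareSeries cs ρ (minimalCosetReps cs {2})
      + poincareSeries cs ρ (minimalCosetReps cs {1, 2})
      + poincareSeries cs ρ (minimalCosetReps cs {0, 2})
      + poincareSeries cs ρ (minimalCosetReps cs {0, 1}) = 1 := by
  classical
  have h1 : (1 : PowerSeries (Module.End k V)) = poincareSeries cs ρ {1} := by
    rw [poincareSeries_singleton, poincareTerm_one]
  rw [h1]
  ext1 n
  simp only [map_add, map_sub, coeff_poincareSeries, ← Finset.sum_add_distrib,
    ← Finset.sum_sub_distrib]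
  refine Finset.sum_congr rfl fun w _ => ?_
  have hall : w = 1 ↔ ¬ cs.IsRightDescent w 0 ∧ ¬ cs.IsRightDescent w 1 ∧
      ¬ cs.IsRightDescent w 2 := by
    constructor
    · rintro rfl
      exact ⟨cs.not_isRightDescent_one 0, cs.not_isRightDescent_one 1,
        cs.not_isRightDescent_one 2⟩
    · rintro ⟨h0, h1, h2⟩
      by_contra hw
      obtain ⟨i, hi⟩ := cs.exists_rightDescent_of_ne_one hw
      fin_cases i
      exacts [h0 hi, h1 hi, h2 hi]
  have hne : ¬ cs.IsRightDescent w 0 ∨ ¬ cs.IsRightDescent w 1 ∨ ¬ cs.IsRightDescent w 2 := by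
    obtain ⟨i, hi⟩ := exists_not_isRightDescent cs w
    fin_cases i
    exacts [Or.inl hi, Or.inr (Or.inl hi), Or.inr (Or.inr hi)]
  simp only [minimalCosetReps, Set.mem_ofPred_eq, Set.mem_univ, if_true, Finset.mem_insert,
    Finset.mem_singleton, forall_eq_or_imp, forall_eq, Set.mem_singleton_iff, hall]
  by_cases h0 : cs.IsRightDescent w 0 <;> by_cases h1 : cs.IsRightDescent w 1 <;>
    by_cases h2 : cs.IsRightDescent w 2 <;> simp [h0, h1, h2] at hne ⊢

end Parabolic

/-! ### Certificates for reduced, parabolic and straight words -/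

section Words

variable {W : Type*} [Group W] {t : AffineType} (cs : CoxeterSystem t.coxeterMatrix W)

namespace AffineType

/-- A criterion for a word to be reduced, in terms of positive roots. -/
def IsReducedWord (t : AffineType) (ω : List (Fin 3)) : Prop :=
  ∀ n : Fin ω.length, ∀ l, 0 ≤ (ω.take n).foldr t.reflectRoot (simpleRoot ω[n]) l

instance (t : AffineType) (ω : List (Fin 3)) : Decidable (t.IsReducedWord ω) :=
  inferInstanceAs (Decidable (∀ n : Fin ω.length, ∀ l,
    0 ≤ (ω.take n).foldr t.reflectRoot (simpleRoot ω[n]) l))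

/-- The action of a word on the simple roots. -/
def wordAction (t : AffineType) (ω : List (Fin 3)) (i : Fin 3) : Fin 3 → ℤ :=
  ω.foldr t.reflectRoot (simpleRoot i)

/-- `L` is a list of reduced words for the elements of the parabolic subgroup `W_I`. -/
structure IsParabolicList (t : AffineType) (I : Finset (Fin 3)) (L : List (List (Fin 3))) :
    Prop where
  nil_mem : [] ∈ L
  mem : ∀ ω ∈ L, ∀ i ∈ ω, i ∈ I
  isReducedWord : ∀ ω ∈ L, t.IsReducedWord ω
  nodup : (L.map t.wordAction).Nodup
  closed : ∀ i ∈ I, ∀ ω ∈ L, ∃ ω' ∈ L, t.wordAction (i :: ω) = t.wordAction ω'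

end AffineType

theorem wordAction_eq (ω : List (Fin 3)) (i : Fin 3) :
    t.wordAction ω i = rootRep cs (cs.wordProd ω) (simpleRoot i) :=
  (rootRep_wordProd cs ω _).symm

theorem wordProd_eq_of_wordAction_eq {ω ω' : List (Fin 3)} (h : t.wordAction ω = t.wordAction ω') :
    cs.wordProd ω = cs.wordProd ω' :=
  eq_of_rootRep_simpleRoot cs fun i => by rw [← wordAction_eq, ← wordAction_eq, h]

/-- The prefixes gain one in length at each letter, since each prefix maps the next simple root to a
positive root. -/
theorem isReduced_of_isReducedWord {ω : List (Fin 3)} (h : t.IsReducedWord ω) :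
    cs.IsReduced ω := by
  have key : ∀ n ≤ ω.length, cs.length (cs.wordProd (ω.take n)) = n := by
    intro n
    induction n with
    | zero => simp
    | succ n ih =>
      intro hn
      rw [List.take_succ_eq_append_getElem (by omega), cs.wordProd_append, cs.wordProd_singleton,
        length_mul_simple_of_nonneg, ih (by omega)]
      rw [rootRep_wordProd]
      exact h ⟨n, by omega⟩
  have := key ω.length le_rfl
  rwa [List.take_length] at this

/-- The listed elements contain 1 and are stable under left multiplication by the generators of W_I,
which are their own inverses. -/
theorem parabolic_eq_of_isParabolicList {I : Finset (Fin 3)} {L : List (List (Fin 3))}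
    (h : t.IsParabolicList I L) : (parabolic cs I : Set W) = {w | w ∈ L.map cs.wordProd} := by
  ext w
  simp only [SetLike.mem_coe, Set.mem_ofPred_eq, List.mem_map]
  constructor
  · intro hw
    have hmul : ∀ i ∈ I, ∀ y, (∃ ω ∈ L, cs.wordProd ω = y) →
        ∃ ω ∈ L, cs.wordProd ω = cs.simple i * y := by
      rintro i hi _ ⟨ω, hω, rfl⟩
      obtain ⟨ω', hω', e⟩ := h.closed i hi ω hω
      exact ⟨ω', hω', by rw [← wordProd_eq_of_wordAction_eq cs e, cs.wordProd_cons]⟩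
    induction hw using Subgroup.closure_induction_left with
    | one => exact ⟨[], h.nil_mem, cs.wordProd_nil⟩
    | mul_left x hx y hy ih =>
      obtain ⟨i, hi, rfl⟩ := hx
      exact hmul i hi y ih
    | inv_mul_cancel x hx y hy ih =>
      obtain ⟨i, hi, rfl⟩ := hx
      rw [cs.inv_simple]
      exact hmul i hi y ih
  · rintro ⟨ω, hω, rfl⟩
    refine Subgroup.list_prod_mem _ fun x hx => ?_
    obtain ⟨i, hi, rfl⟩ := List.mem_map.mp hx
    exact simple_mem_parabolic cs (h.mem ω hω i hi)

variable {k : Type*} [CommRing k] {q : k} {V : Type*} [AddCommGroup V] [Module k V]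
variable (ρ : HeckeAlgebra cs q →ₐ[k] Module.End k V)

theorem poincareSeries_parabolic_of_isParabolicList {I : Finset (Fin 3)}
    {L : List (List (Fin 3))} (h : t.IsParabolicList I L) :
    poincareSeries cs ρ (parabolic cs I) =
      (L.map fun ω => (ω.map fun i => poincareTerm cs ρ (cs.simple i)).prod).sum := by
  rw [parabolic_eq_of_isParabolicList cs h, poincareSeries_list cs ρ
    (fun ω hω => isReduced_of_isReducedWord cs (h.isReducedWord ω hω))]
  refine List.Nodup.of_map (fun w i => rootRep cs w (simpleRoot i)) ?_
  rw [List.map_map]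
  convert h.nodup using 2
  ext ω i : 2
  exact (wordAction_eq cs ω i).symm

/-- If the square of `ω` acts on the roots made negative by `ω⁻¹` by adding nonnegative multiples
of `δ`, then lengths of powers of `ω` are additive. -/
structure AffineType.IsStraightWord (t : AffineType) (ω : List (Fin 3)) : Prop where
  isReducedWord : t.IsReducedWord (ω ++ ω)
  square : ∀ n : Fin ω.length, ∃ c : Fin 10,
    (ω ++ ω ++ ω.take n).foldr t.reflectRoot (simpleRoot ω[n]) =
      (ω.take n).foldr t.reflectRoot (simpleRoot ω[n]) + (c : ℤ) • t.delta

theorem length_pow_mul_of_isStraightWord {ω : List (Fin 3)} (h : t.IsStraightWord ω) (n : ℕ) :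
    cs.length (cs.wordProd ω ^ n * cs.wordProd ω) =
      cs.length (cs.wordProd ω ^ n) + cs.length (cs.wordProd ω) := by
  have hω : cs.IsReduced (ω ++ ω) := isReduced_of_isReducedWord cs h.isReducedWord
  have hω1 : cs.IsReduced ω := by simpa using hω.take ω.length
  -- The roots here are the inversions of the inverse of the word. If all powers keep them positive,
  -- appending one more copy of the word gains length at every letter.
  have hpos : ∀ (m : ℕ) (j : Fin ω.length),
      0 ≤ rootRep cs (cs.wordProd ω ^ m) ((ω.take j).foldr t.reflectRoot (simpleRoot ω[j])) := by
    intro m j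
    induction m using Nat.twoStepInduction with
    | zero =>
      rw [pow_zero, rootRep_one]
      intro l
      have h2 : ω.take j = (ω ++ ω).take j := by rw [List.take_append_of_le_length (by omega)]
      have h3 : ω[j] = (ω ++ ω)[(j : ℕ)]'(by simp; omega) := by
        rw [List.getElem_append_left (by omega)]; rfl
      rw [h2, h3]
      exact h.isReducedWord ⟨j, by simp; omega⟩ l
    | one =>
      rw [pow_one, rootRep_wordProd, ← List.foldr_append]
      intro l
      have h2 : ω ++ ω.take j = (ω ++ ω).take (ω.length + j) := by
        rw [List.take_length_add_append]
      have h3 : ω[j] = (ω ++ ω)[ω.length + j]'(by simp) := by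
        rw [List.getElem_append_right (by omega)]; simp
      rw [h2, h3]
      exact h.isReducedWord ⟨ω.length + j, by simp⟩ l
    -- The square adds c δ with c ≥ 0 and δ is invariant, so the exponents m and m + 2 differ by a
    -- nonnegative vector. This is why two base cases are needed; the reducedness of the doubled
    -- word provides both.
    | more m ih _ =>
      obtain ⟨c, hc⟩ := h.square j
      rw [pow_add, rootRep_mul, pow_two, rootRep_mul, rootRep_wordProd cs ω, rootRep_wordProd cs ω,
        ← List.foldr_append, ← List.foldr_append, hc, map_add, map_smul,
        rootRep_delta]
      exact add_nonneg ih (smul_nonneg (by positivity) fun i => (t.delta_pos i).le)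
  have key : ∀ j ≤ ω.length, cs.length (cs.wordProd ω ^ n * cs.wordProd (ω.take j)) =
      cs.length (cs.wordProd ω ^ n) + j := by
    intro j
    induction j with
    | zero => simp
    | succ j ih =>
      intro hj
      rw [List.take_succ_eq_append_getElem (by omega), cs.wordProd_append, cs.wordProd_singleton,
        ← mul_assoc, length_mul_simple_of_nonneg, ih (by omega), add_assoc]
      rw [rootRep_mul, rootRep_wordProd cs (ω.take j)]
      exact hpos n ⟨j, by omega⟩
  have := key ω.length le_rfl
  rw [List.take_length] at this
  rw [this, hω1.eq]

end Words

/-! ### Noncommutative identities from the braid relations -/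

section RingIdentities

variable {R : Type*} [Ring R]

theorem eq_val_of_mul_eq_one {W m : R} {P : Rˣ} (hW : W * m = 1) (h : ↑P⁻¹ = m) : W = P := by
  rw [← h] at hW
  rw [← mul_one W, ← P.inv_mul, ← mul_assoc, hW, one_mul]

theorem eq_val_of_mul_mul_eq {W m X : R} {p r P : Rˣ} (hW : W * m = 1)
    (h : (p : R) * m * r = X) (hP : ((P⁻¹ : Rˣ) : R) = (p⁻¹ : Rˣ) * X * (r⁻¹ : Rˣ)) : W = P := by
  refine eq_val_of_mul_eq_one hW ?_
  rw [hP, ← h]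
  simp [mul_assoc]

theorem val_inv_of_mul_eq_one {g : Rˣ} {y : R} (h : (g : R) * y = 1) : ((g⁻¹ : Rˣ) : R) = y := by
  rw [← mul_one ((g⁻¹ : Rˣ) : R), ← h, Units.inv_mul_cancel_left]

/-- The polynomial part of the computation for `eq_prod_A2`, left over once the terms with the
inverse of the series of {s₂, s₃} have cancelled. -/
theorem alternating_identity_A2 {x y z : R} (hxy : y * x * y = x * y * x)
    (hxz : z * x * z = x * z * x) :
    (1 + x + z * x) * x * (1 + y) + z * x * ((1 - z * y * x) * (1 + y)) +
      ((1 + x + z + x * z + z * x + x * z * x) * (1 + x + y + x * y + y * x + x * y * x) -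
        (1 + z + x * z) * (1 + x + y + x * y + y * x + x * y * x) -
        (1 + x + z + x * z + z * x + x * z * x) * (1 + x + x * y) -
        (1 + x + z * x) * (1 + x + y + x * y + y * x + x * y * x) +
        (1 + x + y + x * y + y * x + x * y * x) + (1 + x + z + x * z + z * x + x * z * x)) = 0 := by
  simp only [mul_assoc] at hxy hxz
  have hxz' : ∀ r, z * (x * (z * r)) = x * (z * (x * r)) := fun r => by
    simpa only [mul_assoc] using congrArg (· * r) hxz
  simp only [mul_add, add_mul, mul_sub, sub_mul, mul_one, one_mul, mul_assoc, hxy, hxz']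
  abel

/-- The right side is the alternating sum after clearing inverses as in
`mul_alternating_mul_of_commute`; the left side displays its factorization. -/
theorem alternating_identity_C2 {x y z : R} (hxy : x * y * x * y = y * x * y * x) (hyz : z * y = y * z) :
    (1 + x) * (1 - z * x * y) * (1 - z * x * y * x) =
      (1 + x + z * x + x * z * x) * z * y * (1 + x + x * y + x * y * x) -
      (1 + x + z * x + x * z * x) * (1 + z) * (1 + y + y * x + y * x * y) +
      (1 + x) * (1 + y + y * x + y * x * y) + (1 + x + z * x + x * z * x) * (1 + z) := by
  simp only [mul_assoc] at hxy hyz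
  have hyz' : ∀ r, z * (y * r) = y * (z * r) := fun r => by
    rw [← mul_assoc, hyz, mul_assoc]
  simp only [mul_add, add_mul, mul_sub, sub_mul, mul_one, one_mul, mul_assoc, hxy, hyz, hyz']
  abel

theorem alternating_identity_G2 {x y z : R} (hxy : x * y * x * y * x * y = y * x * y * x * y * x)
    (hxz : z * x * z = x * z * x) (hyz : z * y = y * z) :
    (1 - z * x * y) * (1 - z * x * y * x * y) * (1 + x) =
      (1 + x + z * x) * z * y * (1 + x + x * y + x * y * x + x * y * x * y + x * y * x * y * x) -
      (1 + x + z * x) * (1 + z) *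
        (1 + y + y * x + y * x * y + y * x * y * x + y * x * y * x * y) +
      (1 + x) * (1 + y + y * x + y * x * y + y * x * y * x + y * x * y * x * y) +
        (1 + x + z * x) * (1 + z) := by
  simp only [mul_assoc] at hxy hxz hyz
  have hxy' : ∀ r, x * (y * (x * (y * (x * (y * r))))) = y * (x * (y * (x * (y * (x * r))))) :=
    fun r => by
    simpa only [mul_assoc] using congrArg (· * r) hxy
  have hxz' : ∀ r, z * (x * (z * r)) = x * (z * (x * r)) := fun r => by
    simpa only [mul_assoc] using congrArg (· * r) hxz
  have hyz' : ∀ r, z * (y * r) = y * (z * r) := fun r => by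
    rw [← mul_assoc, hyz, mul_assoc]
  -- Moving y to the left of z hides the pattern zxz inside zxzy, so this overlap needs a rewriting
  -- rule of its own.
  have hxyz : ∀ r, z * (x * (y * (z * r))) = x * (z * (x * (y * r))) := fun r => by
    rw [← hyz', hxz']
  simp only [mul_add, add_mul, mul_sub, sub_mul, mul_one, one_mul, mul_assoc, hxy, hxz, hyz, hxy',
    hyz', hxyz]
  abel

/-- Since y and z do not commute, `u₂₃⁻¹` survives the multiplication by `u₁₃` and `u₁₂`. It ends up
between two blocks, one containing 1 - zxy and the other 1 - zyx. -/
theorem eq_prod_A2 {x y z W : R} (hxy : y * x * y = x * y * x)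
    (hxz : z * x * z = x * z * x) {u₁ u₂ u₃ u₁₂ u₁₃ u₂₃ g₁ g₂ : Rˣ}
    (h₁ : (u₁ : R) = 1 + x) (h₂ : (u₂ : R) = 1 + y) (h₃ : (u₃ : R) = 1 + z)
    (h₁₂ : (u₁₂ : R) = 1 + x + y + x * y + y * x + x * y * x)
    (h₁₃ : (u₁₃ : R) = 1 + x + z + x * z + z * x + x * z * x)
    (h₂₃ : (u₂₃ : R) = 1 + y + z + y * z + z * y + z * y * z)
    (hg₁ : (g₁ : R) * (1 - z * y * x) = 1) (hg₂ : (g₂ : R) * (1 - z * x * y) = 1)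
    (hW : W * (1 - ↑u₁⁻¹ - ↑u₂⁻¹ - ↑u₃⁻¹ + ↑u₂₃⁻¹ + ↑u₁₃⁻¹ + ↑u₁₂⁻¹) = 1) :
    W = ↑(u₁₂ * u₂⁻¹ * g₁ * u₂₃ * u₃⁻¹ * g₂ * u₁⁻¹ * u₁₃) := by
  have e₁ : (u₁ : R) * (1 - z * x * y) * u₃ = u₁₃ - z * x * u₂₃ := by
    rw [h₁, h₃, h₁₃, h₂₃]
    simp only [mul_add, add_mul, mul_sub, sub_mul, mul_one, one_mul, ← mul_assoc, hxz]
    abel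
  have e₂ : (1 - z * y * x) * u₂ = u₁₂ - (1 + y + z * y) * x * u₂ := by
    rw [h₂, h₁₂]
    simp only [mul_add, add_mul, sub_mul, mul_one, one_mul, hxy]
    abel
  have e₃ : (u₂₃⁻¹ : Rˣ) * (1 + y + z * y) = (u₃⁻¹ : Rˣ) := by
    rw [Units.inv_mul_eq_iff_eq_mul, Units.eq_mul_inv_iff_mul_eq, h₃, h₂₃]
    simp only [mul_add, add_mul, mul_one, one_mul]
    abel
  have e₄ : (u₁₃ : R) * (u₃⁻¹ : Rˣ) = 1 + x + z * x := by
    rw [Units.mul_inv_eq_iff_eq_mul, h₃, h₁₃, ← hxz]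
    simp only [mul_add, add_mul, mul_one, one_mul]
    abel
  have e₅ : (u₁₃ : R) * (u₁⁻¹ : Rˣ) = 1 + z + x * z := by
    rw [Units.mul_inv_eq_iff_eq_mul, h₁, h₁₃]
    simp only [mul_add, add_mul, mul_one, one_mul]
    abel
  have e₆ : (u₂⁻¹ : Rˣ) * (u₁₂ : R) = 1 + x + x * y := by
    rw [Units.inv_mul_eq_iff_eq_mul, h₂, h₁₂, ← hxy]
    simp only [mul_add, add_mul, mul_one, one_mul, ← mul_assoc]
    abel
  have e₇ := alternating_identity_A2 hxy hxz
  rw [← h₁₂, ← h₁₃, ← h₂] at e₇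
  -- By `e₁` and `e₂` the two blocks agree with `u₁₃` and `u₁₂` up to corrections that absorb
  -- `u₂₃⁻¹`, leaving `u₁₃ u₂₃⁻¹ u₁₂` as the only term that contains it.
  have e₈ : (u₁ : R) * (1 - z * x * y) * u₃ * (u₂₃⁻¹ : Rˣ) * (1 - z * y * x) * u₂ =
      u₁₃ * (u₂₃⁻¹ : Rˣ) * u₁₂ - (1 + x + z * x) * x * u₂ - z * x * ((1 - z * y * x) * u₂) := by
    calc _ = u₁₃ * (u₂₃⁻¹ : Rˣ) * ((1 - z * y * x) * u₂) -
          z * x * (u₂₃ * (u₂₃⁻¹ : Rˣ)) * ((1 - z * y * x) * u₂) := by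
          rw [e₁]; noncomm_ring
      _ = u₁₃ * (u₂₃⁻¹ : Rˣ) * u₁₂ - u₁₃ * ((u₂₃⁻¹ : Rˣ) * (1 + y + z * y)) * x * u₂ -
          z * x * ((1 - z * y * x) * u₂) := by
          rw [u₂₃.mul_inv]; nth_rewrite 1 [e₂]; noncomm_ring
      _ = _ := by rw [e₃, e₄]
  have e₉ : (u₁₃ : R) * (1 - ↑u₁⁻¹ - ↑u₂⁻¹ - ↑u₃⁻¹ + ↑u₂₃⁻¹ + ↑u₁₃⁻¹ + ↑u₁₂⁻¹) * u₁₂ =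
      (u₁ : R) * (1 - z * x * y) * u₃ * (u₂₃⁻¹ : Rˣ) * (1 - z * y * x) * u₂ := by
    rw [e₈]
    calc _ = (u₁₃ : R) * u₁₂ - u₁₃ * (u₁⁻¹ : Rˣ) * u₁₂ - u₁₃ * ((u₂⁻¹ : Rˣ) * u₁₂) -
          u₁₃ * (u₃⁻¹ : Rˣ) * u₁₂ + u₁₃ * (u₂₃⁻¹ : Rˣ) * u₁₂ + (u₁₃ * (u₁₃⁻¹ : Rˣ)) * u₁₂ +
          u₁₃ * ((u₁₂⁻¹ : Rˣ) * u₁₂) := by noncomm_ring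
      _ = _ := by
        rw [e₄, e₅, e₆, u₁₃.mul_inv, u₁₂.inv_mul, one_mul, mul_one, ← sub_eq_zero, ← e₇]
        abel
  refine eq_val_of_mul_mul_eq hW e₉ ?_
  simp only [mul_inv_rev, inv_inv, Units.val_mul, val_inv_of_mul_eq_one hg₁,
    val_inv_of_mul_eq_one hg₂, mul_assoc]

theorem units_eq_mul {y z : R} {u₂ u₃ u₂₃ : Rˣ} (h₂ : (u₂ : R) = 1 + y) (h₃ : (u₃ : R) = 1 + z)
    (h₂₃ : (u₂₃ : R) = (1 + y) * (1 + z)) : u₂₃ = u₂ * u₃ :=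
  Units.ext (by rw [h₂₃, Units.val_mul, h₂, h₃])

theorem units_commute {y z : R} {u₂ u₃ : Rˣ} (h₂ : (u₂ : R) = 1 + y) (h₃ : (u₃ : R) = 1 + z)
    (hyz : z * y = y * z) : u₂ * u₃ = u₃ * u₂ :=
  Units.ext (by
    simp only [Units.val_mul, h₂, h₃, mul_add, add_mul, mul_one, one_mul, hyz]
    abel)

/-- The alternating sum for a Coxeter system in which the reflections `y` and `z` commute. -/
theorem mul_alternating_mul_of_commute {x y z p r s : R}
    {u₁ u₂ u₃ u₁₂ u₁₃ u₂₃ : Rˣ}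
    (h₁ : (u₁ : R) = 1 + x) (h₂ : (u₂ : R) = 1 + y) (h₃ : (u₃ : R) = 1 + z)
    (h₂₃ : (u₂₃ : R) = (1 + y) * (1 + z)) (hp : (u₁₃ : R) = p * (1 + z))
    (hr : (u₁₂ : R) = (1 + y) * r) (hs : (u₁₂ : R) = (1 + x) * s) :
    (u₁₃ : R) * (1 - ↑u₁⁻¹ - ↑u₂⁻¹ - ↑u₃⁻¹ + ↑u₂₃⁻¹ + ↑u₁₃⁻¹ + ↑u₁₂⁻¹) * u₁₂ =
      p * z * y * r - u₁₃ * s + u₁₂ + u₁₃ := by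
  have e₁ : (u₁⁻¹ : Rˣ) * (u₁₂ : R) = s := by
    rw [Units.inv_mul_eq_iff_eq_mul, h₁, hs]
  have e₂ : (u₂⁻¹ : Rˣ) * (u₁₂ : R) = r := by
    rw [Units.inv_mul_eq_iff_eq_mul, h₂, hr]
  have e₃ : (u₁₃ : R) * (u₃⁻¹ : Rˣ) = p := by
    rw [Units.mul_inv_eq_iff_eq_mul, h₃, hp]
  -- Here `u₂₃⁻¹ = u₃⁻¹ u₂⁻¹`, and each of these two inverses is absorbed by its neighbour;
  -- therefore no inverse remains.
  have e₄ : (u₁₃ : R) * (u₂₃⁻¹ : Rˣ) * u₁₂ = p * r := by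
    rw [units_eq_mul h₂ h₃ h₂₃, mul_inv_rev, Units.val_mul,
      ← e₂, ← e₃]
    simp only [mul_assoc]
  calc _ = (u₁₃ : R) * u₁₂ - u₁₃ * ((u₁⁻¹ : Rˣ) * u₁₂) - u₁₃ * ((u₂⁻¹ : Rˣ) * u₁₂) -
        u₁₃ * (u₃⁻¹ : Rˣ) * u₁₂ + u₁₃ * (u₂₃⁻¹ : Rˣ) * u₁₂ + (u₁₃ * (u₁₃⁻¹ : Rˣ)) * u₁₂ +
        u₁₃ * ((u₁₂⁻¹ : Rˣ) * u₁₂) := by noncomm_ring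
    _ = u₁₃ * u₁₂ - u₁₃ * s - u₁₃ * r - p * u₁₂ + p * r + u₁₂ + u₁₃ := by
      rw [e₁, e₂, e₃, e₄, u₁₃.mul_inv, u₁₂.inv_mul, one_mul, mul_one]
    _ = p * (1 + z) * ((1 + y) * r) - u₁₃ * s - p * (1 + z) * r - p * ((1 + y) * r) + p * r +
        u₁₂ + u₁₃ := by
      rw [← hr, ← hp]
    _ = _ := by noncomm_ring

/-- In the types with s₂s₃ = s₃s₂, three of the nine factors are not needed. They cancel among
themselves and can be put at the front. -/
theorem prod_eq_one_of_commute {u₂ u₃ u₂₃ : Rˣ} (h : u₂₃ = u₂ * u₃) (h' : u₂ * u₃ = u₃ * u₂) :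
    u₂⁻¹ * u₃⁻¹ * u₂₃ = 1 := by
  rw [h, h', mul_assoc, inv_mul_cancel_left, inv_mul_cancel]

theorem eq_prod_C2 {x y z W : R} (hxy : x * y * x * y = y * x * y * x)
    (hyz : z * y = y * z) {u₁ u₂ u₃ u₁₂ u₁₃ u₂₃ g₁ g₂ : Rˣ}
    (h₁ : (u₁ : R) = 1 + x) (h₂ : (u₂ : R) = 1 + y) (h₃ : (u₃ : R) = 1 + z)
    (h₁₂ : (u₁₂ : R) = (1 + x) * (1 + y + y * x + y * x * y))
    (h₁₃ : (u₁₃ : R) = (1 + x + z * x + x * z * x) * (1 + z))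
    (h₂₃ : (u₂₃ : R) = (1 + y) * (1 + z))
    (hg₁ : (g₁ : R) * (1 - z * x * y * x) = 1) (hg₂ : (g₂ : R) * (1 - z * x * y) = 1)
    (hW : W * (1 - ↑u₁⁻¹ - ↑u₂⁻¹ - ↑u₃⁻¹ + ↑u₂₃⁻¹ + ↑u₁₃⁻¹ + ↑u₁₂⁻¹) = 1) :
    W = ↑(u₂⁻¹ * u₃⁻¹ * u₂₃ * u₁₂ * g₁ * g₂ * u₁⁻¹ * u₁₃) := by
  have hr : (u₁₂ : R) = (1 + y) * (1 + x + x * y + x * y * x) := by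
    rw [h₁₂]
    simp only [mul_add, add_mul, mul_one, one_mul, ← mul_assoc, hxy]
    abel
  refine eq_val_of_mul_mul_eq hW (mul_alternating_mul_of_commute h₁ h₂ h₃ h₂₃ h₁₃ hr h₁₂) ?_
  rw [prod_eq_one_of_commute (units_eq_mul h₂ h₃ h₂₃) (units_commute h₂ h₃ hyz), one_mul]
  have := alternating_identity_C2 hxy hyz
  rw [← h₁₂, ← h₁₃] at this
  rw [← this]
  simp only [h₁, mul_inv_rev, inv_inv, Units.val_mul, val_inv_of_mul_eq_one hg₁,
    val_inv_of_mul_eq_one hg₂, mul_assoc]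

theorem eq_prod_G2 {x y z W : R} (hxy : x * y * x * y * x * y = y * x * y * x * y * x)
    (hxz : z * x * z = x * z * x)
    (hyz : z * y = y * z) {u₁ u₂ u₃ u₁₂ u₁₃ u₂₃ g₁ g₂ : Rˣ}
    (h₁ : (u₁ : R) = 1 + x) (h₂ : (u₂ : R) = 1 + y) (h₃ : (u₃ : R) = 1 + z)
    (h₁₂ : (u₁₂ : R) =
      (1 + x) * (1 + y + y * x + y * x * y + y * x * y * x + y * x * y * x * y))
    (h₁₃ : (u₁₃ : R) = (1 + x + z * x) * (1 + z))
    (h₂₃ : (u₂₃ : R) = (1 + y) * (1 + z))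
    (hg₁ : (g₁ : R) * (1 - z * x * y) = 1) (hg₂ : (g₂ : R) * (1 - z * x * y * x * y) = 1)
    (hW : W * (1 - ↑u₁⁻¹ - ↑u₂⁻¹ - ↑u₃⁻¹ + ↑u₂₃⁻¹ + ↑u₁₃⁻¹ + ↑u₁₂⁻¹) = 1) :
    W = ↑(u₂⁻¹ * u₃⁻¹ * u₂₃ * u₁₂ * u₁⁻¹ * g₂ * g₁ * u₁₃) := by
  have hr : (u₁₂ : R) =
      (1 + y) * (1 + x + x * y + x * y * x + x * y * x * y + x * y * x * y * x) := by
    rw [h₁₂]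
    simp only [mul_add, add_mul, mul_one, one_mul, ← mul_assoc, hxy]
    abel
  refine eq_val_of_mul_mul_eq hW (mul_alternating_mul_of_commute h₁ h₂ h₃ h₂₃ h₁₃ hr h₁₂) ?_
  rw [prod_eq_one_of_commute (units_eq_mul h₂ h₃ h₂₃) (units_commute h₂ h₃ hyz), one_mul]
  have := alternating_identity_G2 hxy hxz hyz
  rw [← h₁₂, ← h₁₃] at this
  rw [← this]
  simp only [h₁, mul_inv_rev, inv_inv, Units.val_mul, val_inv_of_mul_eq_one hg₁,
    val_inv_of_mul_eq_one hg₂, mul_assoc]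

end RingIdentities

/-! ### Explicit words in the three types -/

namespace AffineType

/-- A reduced word for the generator of the stabilizer of the standard straight strip. -/
def stripWord : AffineType → Fin 2 → List (Fin 3)
  | A2 => ![[2, 1, 0], [2, 0, 1]]
  | C2 => ![[2, 0, 1, 0], [2, 0, 1]]
  | G2 => ![[2, 0, 1], [2, 0, 1, 0, 1]]

/-- These elements act as translations or glide reflections, so their squares are translations and
shift roots by multiples of δ. The multiples that occur are nonnegative and below 10, which makes
the check finite. -/
theorem isStraightWord_stripWord (t : AffineType) (i : Fin 2) : t.IsStraightWord (t.stripWord i) := by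
  cases t <;> fin_cases i <;> constructor <;> decide +kernel

theorem stripWord_ne (t : AffineType) : ∀ i : Fin 2, t.wordAction (t.stripWord i) ≠ t.wordAction [] := by
  cases t <;> decide +kernel

theorem isParabolicList_empty (t : AffineType) : t.IsParabolicList ∅ [[]] := by
  cases t <;> constructor <;> decide +kernel

theorem isParabolicList_singleton (t : AffineType) (i : Fin 3) :
    t.IsParabolicList {i} [[], [i]] := by
  cases t <;> fin_cases i <;> constructor <;> decide +kernel

theorem isParabolicList_A2 (i j : Fin 3) (h : i ≠ j) : A2.IsParabolicList {i, j}
    [[], [i], [j], [i, j], [j, i], [i, j, i]] := by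
  fin_cases i <;> fin_cases j <;> first | exact absurd rfl h | constructor <;> decide +kernel

theorem isParabolicList_C2 (j : Fin 3) (h : j ≠ 0) : C2.IsParabolicList {0, j}
    [[], [0], [j], [0, j], [j, 0], [0, j, 0], [j, 0, j], [0, j, 0, j]] := by
  fin_cases j <;> first | exact absurd rfl h | constructor <;> decide +kernel

theorem isParabolicList_C2_orthogonal : C2.IsParabolicList {1, 2} [[], [1], [2], [1, 2]] := by
  constructor <;> decide +kernel

theorem isParabolicList_G2 : G2.IsParabolicList {0, 1}
    [[], [0], [1], [0, 1], [1, 0], [0, 1, 0], [1, 0, 1], [0, 1, 0, 1], [1, 0, 1, 0],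
      [0, 1, 0, 1, 0], [1, 0, 1, 0, 1], [0, 1, 0, 1, 0, 1]] := by
  constructor <;> decide +kernel

theorem isParabolicList_G2_three : G2.IsParabolicList {0, 2}
    [[], [0], [2], [0, 2], [2, 0], [2, 0, 2]] := by
  constructor <;> decide +kernel

theorem isParabolicList_G2_orthogonal : G2.IsParabolicList {1, 2} [[], [1], [2], [1, 2]] := by
  constructor <;> decide +kernel

end AffineType

/-! ### The factors as power series -/

section StraightWords

variable {W : Type*} [Group W] {t : AffineType} (cs : CoxeterSystem t.coxeterMatrix W)
variable {k : Type*} [CommRing k] {q : k} {V : Type*} [AddCommGroup V] [Module k V]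
variable (ρ : HeckeAlgebra cs q →ₐ[k] Module.End k V)

/-- The source of the braid relations between x, y, z: both products equal the term of one and the
same group element. -/
theorem prod_poincareTerm_eq_of_wordAction_eq {ω ω' : List (Fin 3)}
    (h : t.wordAction ω = t.wordAction ω') (hω : t.IsReducedWord ω) (hω' : t.IsReducedWord ω') :
    (ω.map fun i => poincareTerm cs ρ (cs.simple i)).prod =
      (ω'.map fun i => poincareTerm cs ρ (cs.simple i)).prod := by
  rw [← poincareTerm_wordProd cs ρ (isReduced_of_isReducedWord cs hω),
    ← poincareTerm_wordProd cs ρ (isReduced_of_isReducedWord cs hω'),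
    wordProd_eq_of_wordAction_eq cs h]

/-- The unit `W_I(ρ, u)`. -/
abbrev parabolicUnit (I : Finset (Fin 3)) : (PowerSeries (Module.End k V))ˣ :=
  poincareUnit cs ρ (parabolic cs I) (one_mem _)

theorem val_parabolicUnit {I : Finset (Fin 3)} {L : List (List (Fin 3))}
    (h : t.IsParabolicList I L) : (parabolicUnit cs ρ I : PowerSeries (Module.End k V)) =
      (L.map fun ω => (ω.map fun i => poincareTerm cs ρ (cs.simple i)).prod).sum := by
  rw [val_poincareUnit, poincareSeries_parabolic_of_isParabolicList cs ρ h]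

theorem val_parabolicUnit_singleton (i : Fin 3) :
    (parabolicUnit cs ρ {i} : PowerSeries (Module.End k V)) =
      1 + poincareTerm cs ρ (cs.simple i) := by
  rw [val_parabolicUnit cs ρ (t.isParabolicList_singleton i)]
  simp

theorem parabolicUnit_empty : parabolicUnit cs ρ ∅ = 1 := by
  ext1
  rw [val_parabolicUnit cs ρ t.isParabolicList_empty]
  simp

/-- Multiplying W(ρ,u) by the inverse of W_I(ρ,u) gives the series of W^I, which turns the count
over descent sets into a right inverse of W(ρ,u). -/
theorem poincareSeries_univ_mul_alternating :
    poincareSeries cs ρ Set.univ * (1 - ↑(parabolicUnit cs ρ {0})⁻¹ - ↑(parabolicUnit cs ρ {1})⁻¹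
      - ↑(parabolicUnit cs ρ {2})⁻¹ + ↑(parabolicUnit cs ρ {1, 2})⁻¹
      + ↑(parabolicUnit cs ρ {0, 2})⁻¹ + ↑(parabolicUnit cs ρ {0, 1})⁻¹) = 1 := by
  have h : ∀ I : Finset (Fin 3), poincareSeries cs ρ Set.univ * ↑(parabolicUnit cs ρ I)⁻¹ =
      poincareSeries cs ρ (minimalCosetReps cs I) := fun I => by
    rw [Units.mul_inv_eq_iff_eq_mul, val_poincareUnit, poincareSeries_minimalCosetReps_mul]
  simp only [mul_add, mul_sub, mul_one, h]
  exact poincareSeries_minimalCosetReps_alternating cs ρ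

theorem poincareUnit_powers_mul (i : Fin 2) :
    (poincareUnit cs ρ (Submonoid.powers (cs.wordProd (t.stripWord i))) (one_mem _) :
      PowerSeries (Module.End k V)) *
        (1 - ((t.stripWord i).map fun i => poincareTerm cs ρ (cs.simple i)).prod) = 1 := by
  have h := t.isStraightWord_stripWord i
  have hred : cs.IsReduced (t.stripWord i) := by
    simpa using (isReduced_of_isReducedWord cs h.isReducedWord).take (t.stripWord i).length
  rw [val_poincareUnit, ← poincareTerm_wordProd cs ρ hred]
  refine poincareSeries_powers_mul cs ρ (fun e => t.stripWord_ne i ?_)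
    (length_pow_mul_of_isStraightWord cs h)
  ext1 j
  rw [wordAction_eq cs, e, wordAction_eq cs, cs.wordProd_nil]

end StraightWords

/-! ### The orderings of the nine factors -/

section Orderings

variable {W : Type*} [Group W]
variable {k : Type*} [CommRing k] {q : k} {V : Type*} [AddCommGroup V] [Module k V]

/-- The label of `W_I`. -/
abbrev parabolicLabel (I : Finset (Fin 3)) (h : I ≠ Finset.univ := by decide) : FactorLabel :=
  .inr ⟨I, h⟩

/-- There are 2 + 7 labels, so nine distinct ones exhaust them. -/
theorem forall_mem_of_nodup {l : List FactorLabel} (h : l.Nodup) (hl : l.length = 9) (x : FactorLabel) :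
    x ∈ l := by
  have h1 : l.toFinset = Finset.univ := Finset.eq_univ_of_card _ (by
    rw [List.toFinset_card_of_nodup h, hl]
    decide +kernel)
  rw [← List.mem_toFinset, h1]
  exact Finset.mem_univ x

theorem exists_ordering_A2 (cs : CoxeterSystem A2.coxeterMatrix W)
    (ρ : HeckeAlgebra cs q →ₐ[k] Module.End k V) :
    ∃ l : List FactorLabel, l.Nodup ∧ (∀ x, x ∈ l) ∧
      ((l.map (factor cs ρ fun i => cs.wordProd (A2.stripWord i))).prod :
        PowerSeries (Module.End k V)) = poincareSeries cs ρ Set.univ := by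
  -- The order of `eq_prod_A2`, preceded by the factor of the empty set, which is 1.
  refine ⟨[parabolicLabel ∅, parabolicLabel {0, 1}, parabolicLabel {1}, .inl 0,
    parabolicLabel {1, 2}, parabolicLabel {2}, .inl 1, parabolicLabel {0}, parabolicLabel {0, 2}],
    by decide, forall_mem_of_nodup (by decide) rfl, ?_⟩
  have h01 := val_parabolicUnit cs ρ (isParabolicList_A2 0 1 (by decide))
  have h02 := val_parabolicUnit cs ρ (isParabolicList_A2 0 2 (by decide))
  have h12 := val_parabolicUnit cs ρ (isParabolicList_A2 1 2 (by decide))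
  have b01 := prod_poincareTerm_eq_of_wordAction_eq cs ρ (ω := [1, 0, 1]) (ω' := [0, 1, 0])
    (by decide +kernel) (by decide +kernel) (by decide +kernel)
  have b02 := prod_poincareTerm_eq_of_wordAction_eq cs ρ (ω := [2, 0, 2]) (ω' := [0, 2, 0])
    (by decide +kernel) (by decide +kernel) (by decide +kernel)
  have b12 := prod_poincareTerm_eq_of_wordAction_eq cs ρ (ω := [2, 1, 2]) (ω' := [1, 2, 1])
    (by decide +kernel) (by decide +kernel) (by decide +kernel)
  have g0 := poincareUnit_powers_mul cs ρ 0
  have g1 := poincareUnit_powers_mul cs ρ 1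
  simp only [stripWord, Matrix.cons_val_zero, Matrix.cons_val_one, List.map_cons, List.map_nil,
    List.sum_cons, List.sum_nil, List.prod_cons, List.prod_nil, mul_one, add_zero, ← mul_assoc]
    at h01 h02 h12 b01 b02 b12 g0 g1
  rw [eq_prod_A2 b01 b02 (val_parabolicUnit_singleton cs ρ 0) (val_parabolicUnit_singleton cs ρ 1)
    (val_parabolicUnit_singleton cs ρ 2) (h01.trans (by abel)) (h02.trans (by abel))
    (h12.trans (by rw [b12]; abel)) g0 g1 (poincareSeries_univ_mul_alternating cs ρ)]
  simp [factor, stripWord, parabolicUnit_empty, mul_assoc]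

theorem exists_ordering_C2 (cs : CoxeterSystem C2.coxeterMatrix W)
    (ρ : HeckeAlgebra cs q →ₐ[k] Module.End k V) :
    ∃ l : List FactorLabel, l.Nodup ∧ (∀ x, x ∈ l) ∧
      ((l.map (factor cs ρ fun i => cs.wordProd (C2.stripWord i))).prod :
        PowerSeries (Module.End k V)) = poincareSeries cs ρ Set.univ := by
  refine ⟨[parabolicLabel ∅, parabolicLabel {1}, parabolicLabel {2}, parabolicLabel {1, 2},
    parabolicLabel {0, 1}, .inl 0, .inl 1, parabolicLabel {0}, parabolicLabel {0, 2}],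
    by decide, forall_mem_of_nodup (by decide) rfl, ?_⟩
  have h01 := val_parabolicUnit cs ρ (isParabolicList_C2 1 (by decide))
  have h02 := val_parabolicUnit cs ρ (isParabolicList_C2 2 (by decide))
  have h12 := val_parabolicUnit cs ρ isParabolicList_C2_orthogonal
  have b01 := prod_poincareTerm_eq_of_wordAction_eq cs ρ (ω := [0, 1, 0, 1]) (ω' := [1, 0, 1, 0])
    (by decide +kernel) (by decide +kernel) (by decide +kernel)
  have b12 := prod_poincareTerm_eq_of_wordAction_eq cs ρ (ω := [2, 1]) (ω' := [1, 2])
    (by decide +kernel) (by decide +kernel) (by decide +kernel)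
  have g0 := poincareUnit_powers_mul cs ρ 0
  have g1 := poincareUnit_powers_mul cs ρ 1
  simp only [stripWord, Matrix.cons_val_zero, Matrix.cons_val_one, List.map_cons, List.map_nil,
    List.sum_cons, List.sum_nil, List.prod_cons, List.prod_nil, mul_one, add_zero, ← mul_assoc]
    at h01 h02 h12 b01 b12 g0 g1
  rw [eq_prod_C2 b01 b12 (val_parabolicUnit_singleton cs ρ 0) (val_parabolicUnit_singleton cs ρ 1)
    (val_parabolicUnit_singleton cs ρ 2) (h01.trans (by noncomm_ring)) (h02.trans (by noncomm_ring))
    (h12.trans (by noncomm_ring)) g0 g1 (poincareSeries_univ_mul_alternating cs ρ)]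
  simp [factor, stripWord, parabolicUnit_empty, mul_assoc]

theorem exists_ordering_G2 (cs : CoxeterSystem G2.coxeterMatrix W)
    (ρ : HeckeAlgebra cs q →ₐ[k] Module.End k V) :
    ∃ l : List FactorLabel, l.Nodup ∧ (∀ x, x ∈ l) ∧
      ((l.map (factor cs ρ fun i => cs.wordProd (G2.stripWord i))).prod :
        PowerSeries (Module.End k V)) = poincareSeries cs ρ Set.univ := by
  refine ⟨[parabolicLabel ∅, parabolicLabel {1}, parabolicLabel {2}, parabolicLabel {1, 2},
    parabolicLabel {0, 1}, parabolicLabel {0}, .inl 1, .inl 0, parabolicLabel {0, 2}],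
    by decide, forall_mem_of_nodup (by decide) rfl, ?_⟩
  have h01 := val_parabolicUnit cs ρ isParabolicList_G2
  have h02 := val_parabolicUnit cs ρ isParabolicList_G2_three
  have h12 := val_parabolicUnit cs ρ isParabolicList_G2_orthogonal
  have b01 := prod_poincareTerm_eq_of_wordAction_eq cs ρ (ω := [0, 1, 0, 1, 0, 1])
    (ω' := [1, 0, 1, 0, 1, 0]) (by decide +kernel) (by decide +kernel) (by decide +kernel)
  have b02 := prod_poincareTerm_eq_of_wordAction_eq cs ρ (ω := [2, 0, 2]) (ω' := [0, 2, 0])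
    (by decide +kernel) (by decide +kernel) (by decide +kernel)
  have b12 := prod_poincareTerm_eq_of_wordAction_eq cs ρ (ω := [2, 1]) (ω' := [1, 2])
    (by decide +kernel) (by decide +kernel) (by decide +kernel)
  have g0 := poincareUnit_powers_mul cs ρ 0
  have g1 := poincareUnit_powers_mul cs ρ 1
  simp only [stripWord, Matrix.cons_val_zero, Matrix.cons_val_one, List.map_cons, List.map_nil,
    List.sum_cons, List.sum_nil, List.prod_cons, List.prod_nil, mul_one, add_zero, ← mul_assoc]
    at h01 h02 h12 b01 b02 b12 g0 g1
  rw [eq_prod_G2 b01 b02 b12 (val_parabolicUnit_singleton cs ρ 0)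
    (val_parabolicUnit_singleton cs ρ 1) (val_parabolicUnit_singleton cs ρ 2)
    (h01.trans (by noncomm_ring)) (h02.trans (by noncomm_ring)) (h12.trans (by noncomm_ring))
    g0 g1 (poincareSeries_univ_mul_alternating cs ρ)]
  simp [factor, stripWord, parabolicUnit_empty, mul_assoc]

end Orderings

/-! ### Roots as affine functions on the plane -/

namespace AffineType

/-- The linear parts of the affine functions `simpleCoord`. -/
def linCoord (t : AffineType) (d : ℂ) : Fin 3 → ℝ :=
  match t with
  | A2 => ![2 * √3 / 3 * d.im, d.re - √3 / 3 * d.im, - d.re - √3 / 3 * d.im]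
  | C2 => ![d.im, d.re - d.im, - d.re - d.im]
  | G2 => ![2 * √3 / 3 * d.im, (d.re - √3 * d.im) / 3, - d.re - √3 / 3 * d.im]

/-- The simple roots, as affine functions on the plane. They vanish on the sides of the
fundamental chamber. -/
def simpleCoord (t : AffineType) (z : ℂ) : Fin 3 → ℝ := t.linCoord z + ![0, 0, 1]

theorem linCoord_add (t : AffineType) (d e : ℂ) :
    t.linCoord (d + e) = t.linCoord d + t.linCoord e := by
  ext k
  cases t <;> fin_cases k <;> simp [linCoord] <;> ring

theorem linCoord_smul (t : AffineType) (c : ℝ) (d : ℂ) :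
    t.linCoord (c • d) = c • t.linCoord d := by
  ext k
  cases t <;> fin_cases k <;> simp [linCoord] <;> ring

theorem simpleCoord_add (t : AffineType) (z d : ℂ) :
    t.simpleCoord (z + d) = t.simpleCoord z + t.linCoord d := by
  rw [simpleCoord, simpleCoord, linCoord_add]
  abel

theorem eq_zero_of_linCoord (t : AffineType) {d : ℂ} (h0 : t.linCoord d 0 = 0)
    (h1 : t.linCoord d 1 = 0) : d = 0 := by
  have h3 : √3 ≠ 0 := by positivity
  cases t
  · simp [linCoord, h3] at h0 h1
    rw [h0] at h1
    exact Complex.ext (by simpa using h1) h0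
  · simp [linCoord] at h0 h1
    rw [h0] at h1
    exact Complex.ext (by simpa using h1) h0
  · simp [linCoord, h3] at h0 h1
    rw [h0] at h1
    exact Complex.ext (by simpa using h1) h0

theorem reflection_line_apply_of_eq {a b u : ℂ} (h : b - a ≠ 0) (hu : b - a = u * conj (b - a))
    (z : ℂ) : EuclideanGeometry.reflection (affineSpan ℝ {a, b}) z = a + u * conj (z - a) := by
  rw [reflection_line_apply h, (div_eq_iff ((map_ne_zero _).mpr h)).mpr hu]

/-- This matches the Euclidean reflections with the Cartan matrix and makes the plane action
compatible with the lattice action. -/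
theorem simpleCoord_sideReflection (t : AffineType) (i k : Fin 3) (z : ℂ) :
    t.simpleCoord (t.sideReflection i z) k =
      t.simpleCoord z k - t.cartan i k * t.simpleCoord z i := by
  have h3 : √3 ^ 2 = 3 := Real.sq_sqrt (by norm_num)
  -- The reflection in a line of direction d has linear part v ↦ (d / d̄) v̄; `u` is this phase for
  -- the i-th side.
  let u : ℂ := match t, i with
    | _, 0 => 1
    | A2, 1 => ⟨-1 / 2, √3 / 2⟩
    | A2, 2 => ⟨-1 / 2, -√3 / 2⟩
    | C2, 1 => ⟨0, 1⟩
    | C2, 2 => ⟨0, -1⟩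
    | G2, 1 => ⟨1 / 2, √3 / 2⟩
    | G2, 2 => ⟨-1 / 2, -√3 / 2⟩
  have hne : t.vertex (i + 2) - t.vertex (i + 1) ≠ 0 := by
    cases t <;> fin_cases i <;> simp [vertex, Complex.ext_iff]
  have hu : t.vertex (i + 2) - t.vertex (i + 1) =
      u * conj (t.vertex (i + 2) - t.vertex (i + 1)) := by
    cases t <;> fin_cases i <;> simp [vertex, Complex.ext_iff, u] <;> constructor <;> ring_nf <;>
      (try rw [h3]) <;> norm_num
  rw [sideReflection, reflection_line_apply_of_eq hne hu]
  cases t <;> fin_cases i <;> fin_cases k <;>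
    simp [simpleCoord, linCoord, vertex, cartan, u] <;> ring_nf <;> (try simp only [h3]) <;>
    ring_nf

/-- The value at `z` of the affine function given by the element `p` of the root lattice. -/
def rootEval (t : AffineType) (p : Fin 3 → ℤ) (z : ℂ) : ℝ := ∑ k, p k * t.simpleCoord z k

/-- The linear part of `rootEval`. -/
def rootLin (t : AffineType) (p : Fin 3 → ℤ) (d : ℂ) : ℝ := ∑ k, p k * t.linCoord d k

theorem rootEval_add (t : AffineType) (p : Fin 3 → ℤ) (z d : ℂ) :
    t.rootEval p (z + d) = t.rootEval p z + t.rootLin p d := by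
  simp only [rootEval, rootLin, simpleCoord_add, Pi.add_apply, mul_add, Finset.sum_add_distrib]

theorem rootLin_add (t : AffineType) (p : Fin 3 → ℤ) (d e : ℂ) :
    t.rootLin p (d + e) = t.rootLin p d + t.rootLin p e := by
  simp only [rootLin, linCoord_add, Pi.add_apply, mul_add, Finset.sum_add_distrib]

theorem rootLin_smul (t : AffineType) (p : Fin 3 → ℤ) (c : ℝ) (d : ℂ) :
    t.rootLin p (c • d) = c * t.rootLin p d := by
  simp only [rootLin, linCoord_smul, Pi.smul_apply, smul_eq_mul, Finset.mul_sum]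
  exact Finset.sum_congr rfl fun _ _ => by ring

theorem rootLin_sub (t : AffineType) (p : Fin 3 → ℤ) (d e : ℂ) :
    t.rootLin p (d - e) = t.rootLin p d - t.rootLin p e := by
  rw [eq_sub_iff_add_eq, ← rootLin_add, sub_add_cancel]

theorem add_rootEval (t : AffineType) (p p' : Fin 3 → ℤ) (z : ℂ) :
    t.rootEval (p + p') z = t.rootEval p z + t.rootEval p' z := by
  simp [rootEval, add_mul, Finset.sum_add_distrib]

theorem smul_rootEval (t : AffineType) (n : ℤ) (p : Fin 3 → ℤ) (z : ℂ) :
    t.rootEval (n • p) z = n * t.rootEval p z := by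
  simp [rootEval, mul_assoc, Finset.mul_sum]

theorem neg_rootEval (t : AffineType) (p : Fin 3 → ℤ) (z : ℂ) :
    t.rootEval (-p) z = - t.rootEval p z := by
  simp [rootEval]

theorem sub_rootEval (t : AffineType) (p p' : Fin 3 → ℤ) (z : ℂ) :
    t.rootEval (p - p') z = t.rootEval p z - t.rootEval p' z := by
  rw [sub_eq_add_neg, add_rootEval, neg_rootEval, sub_eq_add_neg]

@[simp] theorem rootEval_delta (t : AffineType) (z : ℂ) : t.rootEval t.delta z = 1 := by
  cases t <;> simp [rootEval, delta, simpleCoord, linCoord, Fin.sum_univ_three] <;> ring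

theorem rootLin_eq_sub (t : AffineType) (p : Fin 3 → ℤ) (d : ℂ) :
    t.rootLin p d = t.rootEval p (0 + d) - t.rootEval p 0 := by
  rw [rootEval_add, add_sub_cancel_left]

@[simp] theorem rootLin_delta (t : AffineType) (d : ℂ) : t.rootLin t.delta d = 0 := by
  rw [rootLin_eq_sub, rootEval_delta, rootEval_delta, sub_self]

theorem sub_rootLin (t : AffineType) (p p' : Fin 3 → ℤ) (d : ℂ) :
    t.rootLin (p - p') d = t.rootLin p d - t.rootLin p' d := by
  simp only [rootLin_eq_sub, sub_rootEval]
  ring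

theorem smul_rootLin (t : AffineType) (n : ℤ) (p : Fin 3 → ℤ) (d : ℂ) :
    t.rootLin (n • p) d = n * t.rootLin p d := by
  simp only [rootLin_eq_sub, smul_rootEval]
  ring

theorem rootEval_simpleRoot (t : AffineType) (k : Fin 3) (z : ℂ) :
    t.rootEval (simpleRoot k) z = t.simpleCoord z k := by
  simp [rootEval, Pi.single_apply]

theorem rootLin_simpleRoot (t : AffineType) (k : Fin 3) (d : ℂ) :
    t.rootLin (simpleRoot k) d = t.linCoord d k := by
  simp [rootLin, Pi.single_apply]

theorem rootEval_reflectRoot (t : AffineType) (i : Fin 3) (p : Fin 3 → ℤ) (z : ℂ) :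
    t.rootEval (t.reflectRoot i p) (t.sideReflection i z) = t.rootEval p z := by
  simp only [rootEval, simpleCoord_sideReflection, Fin.sum_univ_three]
  cases t <;> fin_cases i <;> simp [reflectRoot, cartan] <;> ring

/-- The rational quadratic form on the root lattice that is invariant under `W`. -/
def rootForm (t : AffineType) (p p' : Fin 3 → ℤ) : ℤ :=
  match t with
  | A2 => 2 * p 0 * p' 0 + 2 * p 1 * p' 1 + 2 * p 2 * p' 2 - (p 0 * p' 1 + p 1 * p' 0)
      - (p 0 * p' 2 + p 2 * p' 0) - (p 1 * p' 2 + p 2 * p' 1)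
  | C2 => 2 * p 0 * p' 0 + 4 * p 1 * p' 1 + 4 * p 2 * p' 2 - 2 * (p 0 * p' 1 + p 1 * p' 0)
      - 2 * (p 0 * p' 2 + p 2 * p' 0)
  | G2 => 6 * p 0 * p' 0 + 2 * p 1 * p' 1 + 6 * p 2 * p' 2 - 3 * (p 0 * p' 1 + p 1 * p' 0)
      - 3 * (p 0 * p' 2 + p 2 * p' 0)

theorem rootForm_reflectRoot (t : AffineType) (i : Fin 3) (p p' : Fin 3 → ℤ) :
    t.rootForm (t.reflectRoot i p) (t.reflectRoot i p') = t.rootForm p p' := by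
  cases t <;> fin_cases i <;> simp [reflectRoot, cartan, rootForm] <;> ring

end AffineType

/-! ### Compatibility of the plane action with the lattice action -/

section Action

variable {W : Type*} [Group W] {t : AffineType} (cs : CoxeterSystem t.coxeterMatrix W)

theorem planeAction_simple (i : Fin 3) : planeAction cs (cs.simple i) = t.sideReflection i :=
  cs.lift_apply_simple _ i

theorem planeAction_mul_apply (w v : W) (z : ℂ) :
    planeAction cs (w * v) z = planeAction cs w (planeAction cs v z) := by
  rw [map_mul]; rfl

theorem planeAction_one_apply (z : ℂ) : planeAction cs 1 z = z := by
  rw [map_one]; rfl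

theorem planeAction_inv_cancel (w : W) (z : ℂ) :
    planeAction cs w⁻¹ (planeAction cs w z) = z := by
  rw [← planeAction_mul_apply, inv_mul_cancel, planeAction_one_apply]

theorem planeAction_cancel_inv (w : W) (z : ℂ) :
    planeAction cs w (planeAction cs w⁻¹ z) = z := by
  rw [← planeAction_mul_apply, mul_inv_cancel, planeAction_one_apply]

theorem planeAction_add (w : W) (z d : ℂ) : planeAction cs w (z + d) =
    planeAction cs w z + (planeAction cs w).linearIsometryEquiv d := by
  have := (planeAction cs w).map_vadd z d
  simp only [vadd_eq_add] at this
  rw [add_comm, this, add_comm]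

theorem rootEval_rootRep (w : W) (p : Fin 3 → ℤ) (z : ℂ) :
    t.rootEval (rootRep cs w p) (planeAction cs w z) = t.rootEval p z := by
  induction w using cs.simple_induction_left with
  | one => rw [rootRep_one, planeAction_one_apply]
  | mul_simple_left w i ih =>
    rw [rootRep_mul, planeAction_mul_apply, rootRep_simple, planeAction_simple,
      rootEval_reflectRoot, ih]

theorem rootEval_planeAction (w : W) (p : Fin 3 → ℤ) (z : ℂ) :
    t.rootEval p (planeAction cs w z) = t.rootEval (rootRep cs w⁻¹ p) z := by
  conv_lhs => rw [← rootRep_cancel_inv cs w p, rootEval_rootRep]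

theorem rootLin_rootRep (w : W) (p : Fin 3 → ℤ) (d : ℂ) :
    t.rootLin (rootRep cs w p) ((planeAction cs w).linearIsometryEquiv d) = t.rootLin p d := by
  have h1 := rootEval_rootRep cs w p (0 + d)
  rw [planeAction_add, rootEval_add, rootEval_add, rootEval_rootRep] at h1
  exact add_left_cancel h1

theorem rootForm_rootRep (w : W) (p p' : Fin 3 → ℤ) :
    t.rootForm (rootRep cs w p) (rootRep cs w p') = t.rootForm p p' := by
  induction w using cs.simple_induction_left with
  | one => rw [rootRep_one, rootRep_one]
  | mul_simple_left w i ih =>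
    rw [rootRep_mul, rootRep_mul, rootRep_simple, rootRep_simple, rootForm_reflectRoot, ih]

theorem planeAction_simple_eq_iff (k : Fin 3) (z : ℂ) :
    planeAction cs (cs.simple k) z = z ↔ t.simpleCoord z k = 0 := by
  have h2 : t.cartan k k = 2 := by cases t <;> fin_cases k <;> rfl
  rw [planeAction_simple]
  constructor
  · intro h
    have := t.simpleCoord_sideReflection k k z
    rw [h, h2] at this
    push_cast at this
    linarith
  · intro h
    have key : ∀ j, t.linCoord (t.sideReflection k z - z) j = 0 := by
      intro j
      have h1 := t.simpleCoord_sideReflection k j z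
      have h3 := congrFun (t.simpleCoord_add z (t.sideReflection k z - z)) j
      rw [add_sub_cancel, h1, h, Pi.add_apply] at h3
      linarith
    exact sub_eq_zero.mp (t.eq_zero_of_linCoord (key 0) (key 1))

theorem mem_wall_iff (w : W) (k : Fin 3) (z : ℂ) :
    z ∈ wall cs (w * cs.simple k * w⁻¹) ↔ t.rootEval (rootRep cs w (simpleRoot k)) z = 0 := by
  have h1 : t.rootEval (rootRep cs w (simpleRoot k)) z =
      t.simpleCoord (planeAction cs w⁻¹ z) k := by
    rw [← rootEval_simpleRoot, rootEval_planeAction, inv_inv]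
  rw [h1, ← planeAction_simple_eq_iff cs, wall, Set.mem_ofPred_eq, planeAction_mul_apply,
    planeAction_mul_apply]
  constructor
  · intro h
    rw [← planeAction_inv_cancel cs w (planeAction cs (cs.simple k) _), h]
  · intro h
    rw [h, planeAction_cancel_inv]

end Action

/-! ### Normal and tangent vectors of the strips -/

namespace AffineType

/-- The simple root that is orthogonal to the direction `vᵢ` of the fundamental strip `𝒯ᵢ`. -/
abbrev normalRoot (i : Fin 2) : Fin 3 → ℤ := simpleRoot (![1, 0] i)

theorem normalRoot_apply (i : Fin 2) (k : Fin 3) :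
    normalRoot i k = if k = ![1, 0] i then 1 else 0 := Pi.single_apply _ _ _

/-- An element of the root lattice that is orthogonal to `normalRoot i`. -/
def tangentVector : AffineType → Fin 2 → Fin 3 → ℤ
  | A2 => ![![1, 0, -1], ![0, 1, -1]]
  | C2 => ![![0, 0, -1], ![0, 1, -1]]
  | G2 => ![![0, 0, -1], ![0, 1, -1]]

/-- A vertex of the fundamental chamber, as a direction. -/
abbrev direction (t : AffineType) (i : Fin 2) : ℂ := t.vertex i.castSucc

/-- The functions δₖαₖ are the barycentric coordinates of the chamber. Going from v₃ = 0 to vᵢ, the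
i-th one rises by 1, the third one falls by 1 (with δ-coefficient 1), and the other is constant. -/
theorem linCoord_direction (t : AffineType) (i : Fin 2) (k : Fin 3) :
    t.linCoord (t.direction i) k =
      if k = i.castSucc then (t.delta k : ℝ)⁻¹ else if k = 2 then -1 else 0 := by
  have h3 : √3 ^ 2 = 3 := Real.sq_sqrt (by norm_num)
  cases t <;> fin_cases i <;> fin_cases k <;> simp [direction, linCoord, vertex, delta] <;>
    ring_nf <;> (try rw [h3]) <;> norm_num

/-- The defining equation of the elements of the root lattice that vanish on `vᵢ`. -/
theorem eq_of_rootLin_direction_eq_zero (t : AffineType) (i : Fin 2) {p : Fin 3 → ℤ}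
    (h : t.rootLin p (t.direction i) = 0) : p i.castSucc = t.delta i.castSucc * p 2 := by
  have hpos : (t.delta i.castSucc : ℝ) ≠ 0 := by exact_mod_cast (t.delta_pos _).ne'
  have h1 : (p i.castSucc : ℝ) * (t.delta i.castSucc : ℝ)⁻¹ - p 2 = 0 := by
    rw [← h, rootLin]
    simp only [linCoord_direction, Fin.sum_univ_three]
    fin_cases i <;> simp <;> ring
  field_simp at h1
  rw [mul_zero, sub_eq_zero] at h1
  exact_mod_cast h1

@[simp] theorem rootLin_normalRoot (t : AffineType) (i : Fin 2) :
    t.rootLin (normalRoot i) (t.direction i) = 0 := by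
  rw [rootLin_simpleRoot, linCoord_direction]
  fin_cases i <;> simp

theorem rootLin_tangentVector_pos (t : AffineType) (i : Fin 2) :
    0 < t.rootLin (t.tangentVector i) (t.direction i) := by
  simp only [rootLin, linCoord_direction, Fin.sum_univ_three]
  cases t <;> fin_cases i <;> simp [tangentVector, delta] <;> norm_num

theorem eq_zero_of_rootLin (t : AffineType) (i : Fin 2) {d : ℂ}
    (h : t.rootLin (normalRoot i) d = 0) (h' : t.rootLin (t.tangentVector i) d = 0) : d = 0 := by
  have hd := t.rootLin_delta d
  rw [rootLin_simpleRoot] at h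
  simp only [rootLin, Fin.sum_univ_three] at h' hd
  apply t.eq_zero_of_linCoord <;> cases t <;> fin_cases i <;>
    simp [tangentVector, delta] at h h' hd <;> linarith

end AffineType

/-! ### Strips and their middle lines -/

section Strips

variable {W : Type*} [Group W] {t : AffineType} (cs : CoxeterSystem t.coxeterMatrix W)

/-- The real roots parallel to `vᵢ` are the `± αⱼ + n δ`. -/
theorem root_classification (w : W) (k : Fin 3) (i : Fin 2)
    (h : t.rootLin (rootRep cs w (simpleRoot k)) (t.direction i) = 0) :
    ∃ n : ℤ, rootRep cs w (simpleRoot k) = normalRoot i + n • t.delta ∨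
      rootRep cs w (simpleRoot k) = - normalRoot i + n • t.delta := by
  replace h := t.eq_of_rootLin_direction_eq_zero i h
  have h2 := rootForm_rootRep cs w (simpleRoot k) (simpleRoot k)
  have h3 : t.rootForm (simpleRoot k) (simpleRoot k) = match (generalizing := false) t, k with
    | A2, _ => 2
    | C2, 0 => 2
    | C2, _ => 4
    | G2, 1 => 2
    | G2, _ => 6 := by
    cases t <;> fin_cases k <;> rfl
  rw [h3] at h2
  clear h3
  generalize rootRep cs w (simpleRoot k) = p at h h2 ⊢
  -- The last coefficient of δ is 1, so after removing p₂δ only a multiple a of the normal root is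
  -- left. The form sees only this part, and the squared lengths of roots are 2, 4 or 6; since a is
  -- an integer, a² = 1.
  have key : p - p 2 • t.delta = normalRoot i ∨ p - p 2 • t.delta = - normalRoot i := by
    have hsq : ∀ x : ℤ, 2 * x ^ 2 = 2 ∨ 2 * x ^ 2 = 4 ∨ 2 * x ^ 2 = 6 ∨ 4 * x ^ 2 = 2 ∨
        4 * x ^ 2 = 4 ∨ 6 * x ^ 2 = 2 ∨ 6 * x ^ 2 = 6 → x = 1 ∨ x = -1 := by
      intro x hx
      have hy : x ^ 2 = 1 ∨ x ^ 2 = 2 ∨ x ^ 2 = 3 := by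
        generalize x ^ 2 = y at hx
        omega
      have h1 : x ≤ 1 := by rcases hy with h | h | h <;> nlinarith
      have h2 : -1 ≤ x := by rcases hy with h | h | h <;> nlinarith
      have h3 : x ≠ 0 := by rintro rfl; simp at hy
      omega
    have hx : ∀ x, x = p (![1, 0] i) - p 2 * t.delta (![1, 0] i) → x = 1 ∨ x = -1 := by
      intro x hx
      apply hsq
      cases t <;> fin_cases i <;> fin_cases k <;>
        simp [rootForm, delta] at h h2 hx <;> rw [h] at h2 <;> subst hx <;>
        first
          | exact Or.inl (by linarith)
          | exact Or.inr (Or.inl (by linarith))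
          | exact Or.inr (Or.inr (Or.inl (by linarith)))
          | exact Or.inr (Or.inr (Or.inr (Or.inl (by linarith))))
    replace hx := hx _ rfl
    refine hx.imp (fun hx => ?_) (fun hx => ?_) <;> ext l <;> cases t <;> fin_cases i <;>
      fin_cases l <;> simp [delta, normalRoot_apply] at h hx ⊢ <;> omega
  refine ⟨p 2, key.imp (fun h => ?_) (fun h => ?_)⟩ <;> rw [← h, sub_add_cancel]

/-- The affine functions of the two boundary lines of the fundamental strip are real roots. -/
theorem exists_rootRep_eq_delta_sub (i : Fin 2) :
    ∃ w k, rootRep cs w (simpleRoot k) = t.delta - normalRoot i := by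
  obtain ⟨ω, k, h⟩ : ∃ ω k, ∀ l, (ω : List (Fin 3)).foldr t.reflectRoot (simpleRoot k) l =
      (t.delta - normalRoot i) l := by
    cases t <;> fin_cases i
    · exact ⟨[0], 2, by decide +kernel⟩
    · exact ⟨[1], 2, by decide +kernel⟩
    · exact ⟨[0], 2, by decide +kernel⟩
    · exact ⟨[2, 1], 0, by decide +kernel⟩
    · exact ⟨[0, 1, 2, 0], 1, by decide +kernel⟩
    · exact ⟨[2, 1], 0, by decide +kernel⟩
  exact ⟨cs.wordProd ω, k, by rw [rootRep_wordProd]; exact funext h⟩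

theorem rootLin_eq_zero_of_mem_wall {w : W} {k : Fin 3} {d : ℂ}
    {z : ℂ} (hz : z ∈ wall cs (w * cs.simple k * w⁻¹))
    (h : z + d ∈ wall cs (w * cs.simple k * w⁻¹)) :
    t.rootLin (rootRep cs w (simpleRoot k)) d = 0 := by
  rw [mem_wall_iff] at hz h
  rwa [rootEval_add, hz, zero_add] at h

theorem mem_parallelWalls_of_root {w : W} {k : Fin 3} {d : ℂ}
    (hd : t.rootLin (rootRep cs w (simpleRoot k)) d = 0) {z : ℂ}
    (hz : t.rootEval (rootRep cs w (simpleRoot k)) z = 0) : z ∈ parallelWalls cs d := by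
  refine ⟨w * cs.simple k * w⁻¹, ⟨w, k, rfl⟩, fun x hx => ?_, (mem_wall_iff cs w k z).mpr hz⟩
  rw [mem_wall_iff] at hx ⊢
  rw [rootEval_add, hx, hd, add_zero]

/-- The walls parallel to vᵢ lie on lines where the normal root has an integer value, and there is
no integer strictly between 0 and 1. -/
theorem notMem_parallelWalls {i : Fin 2} {z : ℂ} (h0 : 0 < t.rootEval (normalRoot i) z)
    (h1 : t.rootEval (normalRoot i) z < 1) : z ∉ parallelWalls cs (t.direction i) := by
  rintro ⟨_, ⟨w, k, rfl⟩, hr, hz⟩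
  obtain ⟨n, hn⟩ := root_classification cs w k i
    (rootLin_eq_zero_of_mem_wall cs hz (hr z hz))
  rw [mem_wall_iff] at hz
  rcases hn with hn | hn
  · rw [hn, add_rootEval, smul_rootEval, rootEval_delta, mul_one] at hz
    have h2 : (n : ℝ) < 0 := by linarith
    have h3 : (-1 : ℝ) < n := by linarith
    norm_cast at h2 h3
    omega
  · rw [hn, add_rootEval, smul_rootEval, rootEval_delta, mul_one, neg_rootEval] at hz
    have h2 : (n : ℝ) < 1 := by linarith
    have h3 : (0 : ℝ) < n := by linarith
    norm_cast at h2 h3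
    omega

theorem AffineType.continuous_rootEval (t : AffineType) (p : Fin 3 → ℤ) :
    Continuous (t.rootEval p) := by
  unfold rootEval
  refine continuous_finsetSum _ fun k _ => continuous_const.mul ?_
  cases t <;> fin_cases k <;> simp [simpleCoord, linCoord] <;> fun_prop

theorem AffineType.rootEval_combination (t : AffineType) (p : Fin 3 → ℤ) (x y : ℂ) {a b : ℝ}
    (h : a + b = 1) : t.rootEval p (a • x + b • y) = a * t.rootEval p x + b * t.rootEval p y := by
  have h1 : ∀ z, t.rootEval p z = t.rootEval p 0 + t.rootLin p z := fun z => by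
    rw [← rootEval_add, zero_add]
  rw [h1, rootLin_add, rootLin_smul, rootLin_smul, h1 x, h1 y]
  linear_combination (-1 : ℝ) * t.rootEval p 0 * h

theorem AffineType.convex_preimage_rootEval (t : AffineType) (p : Fin 3 → ℤ) {s : Set ℝ}
    (hs : Convex ℝ s) : Convex ℝ (t.rootEval p ⁻¹' s) := by
  intro x hx y hy a b ha hb hab
  rw [Set.mem_preimage, t.rootEval_combination p x y hab]
  exact hs hx hy ha hb hab

theorem AffineType.simpleCoord_vertex (t : AffineType) (i k : Fin 3) :
    t.delta k * t.simpleCoord (t.vertex i) k = if k = i then 1 else 0 := by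
  have h3 : √3 ^ 2 = 3 := Real.sq_sqrt (by norm_num)
  cases t <;> fin_cases i <;> fin_cases k <;> simp [simpleCoord, linCoord, vertex, delta] <;>
    ring_nf <;> (try rw [h3]) <;> norm_num

theorem AffineType.eq_sum_vertex (t : AffineType) (z : ℂ) :
    z = ∑ k, (t.delta k * t.simpleCoord z k) • t.vertex k := by
  have h3 : √3 ^ 2 = 3 := Real.sq_sqrt (by norm_num)
  rw [Fin.sum_univ_three]
  cases t <;> apply Complex.ext <;> simp [simpleCoord, linCoord, vertex, delta] <;>
    ring_nf <;> (try rw [h3]) <;> ring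

/-- The centroid has positive coordinates. Without a point in the chamber, the union that defines
the fundamental strip would be empty. -/
theorem AffineType.chamber_nonempty (t : AffineType) : t.chamber.Nonempty := by
  have hopen : IsOpen {z | ∀ k, 0 < t.simpleCoord z k} := by
    simp only [Set.ofPred_forall]
    refine isOpen_iInter_of_finite fun k => ?_
    simp only [← rootEval_simpleRoot]
    exact isOpen_lt continuous_const (t.continuous_rootEval _)
  have hsub : {z | ∀ k, 0 < t.simpleCoord z k} ⊆ convexHull ℝ (Set.range t.vertex) := by
    intro z hz
    rw [t.eq_sum_vertex z]
    refine (convex_convexHull ℝ _).sum_mem (fun k _ => ?_) ?_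
      fun k _ => subset_convexHull ℝ _ ⟨k, rfl⟩
    · exact mul_nonneg (by exact_mod_cast (t.delta_pos k).le) (hz k).le
    · exact t.rootEval_delta z
  have hc : ∃ z, ∀ k, 0 < t.simpleCoord z k := by
    refine ⟨(1 / 3 : ℝ) • t.vertex 0 + ((2 / 3 : ℝ) • ((1 / 2 : ℝ) • t.vertex 1 +
      (1 / 2 : ℝ) • t.vertex 2)), fun k => ?_⟩
    have hk : (0 : ℝ) < t.delta k := by exact_mod_cast t.delta_pos k
    have h0 := t.simpleCoord_vertex 0 k
    have h1 := t.simpleCoord_vertex 1 k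
    have h2 := t.simpleCoord_vertex 2 k
    have : t.delta k * t.simpleCoord ((1 / 3 : ℝ) • t.vertex 0 + ((2 / 3 : ℝ) •
        ((1 / 2 : ℝ) • t.vertex 1 + (1 / 2 : ℝ) • t.vertex 2))) k = 1 / 3 := by
      simp only [← rootEval_simpleRoot] at h0 h1 h2 ⊢
      rw [rootEval_combination _ _ _ _ (by norm_num), rootEval_combination _ _ _ _ (by norm_num)]
      have e : ((if k = 0 then 1 else 0) + (if k = 1 then 1 else 0) + (if k = 2 then 1 else 0) : ℝ)
          = 1 := by fin_cases k <;> simp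
      rw [← h0, ← h1, ← h2] at e
      linear_combination e / 3
    by_contra hneg
    nlinarith
  obtain ⟨z, hz⟩ := hc
  exact ⟨z, interior_maximal hsub hopen hz⟩

theorem AffineType.exists_rootLin_eq_one (t : AffineType) (i : Fin 2) :
    ∃ d, t.rootLin (normalRoot i) d = 1 := by
  have h3 : √3 ≠ 0 := by positivity
  simp only [rootLin_simpleRoot]
  cases t <;> fin_cases i
  · exact ⟨1, by simp [linCoord]⟩
  · exact ⟨⟨0, √3 / 2⟩, by
      have : √3 * √3 = 3 := Real.mul_self_sqrt (by norm_num)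
      simp [linCoord]; linarith⟩
  · exact ⟨1, by simp [linCoord]⟩
  · exact ⟨⟨0, 1⟩, by simp [linCoord]⟩
  · exact ⟨3, by simp [linCoord]⟩
  · exact ⟨⟨0, √3 / 2⟩, by
      have : √3 * √3 = 3 := Real.mul_self_sqrt (by norm_num)
      simp [linCoord]; linarith⟩

theorem AffineType.chamber_subset (t : AffineType) (i : Fin 2) :
    t.chamber ⊆ t.rootEval (normalRoot i) ⁻¹' Set.Ioo 0 1 := by
  intro z hz
  have hsub : t.chamber ⊆ t.rootEval (normalRoot i) ⁻¹' Set.Icc 0 1 := by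
    refine interior_subset.trans (convexHull_min ?_ (t.convex_preimage_rootEval _ (convex_Icc 0 1)))
    rintro _ ⟨l, rfl⟩
    have h := t.simpleCoord_vertex l (![1, 0] i)
    have h1 : (1 : ℝ) ≤ t.delta (![1, 0] i) := by exact_mod_cast t.delta_pos _
    rw [Set.mem_preimage, rootEval_simpleRoot, Set.mem_Icc]
    split_ifs at h
    · constructor <;> nlinarith
    · rcases mul_eq_zero.mp h with h | h
      · linarith
      · rw [h]; norm_num
  obtain ⟨d, hd⟩ := t.exists_rootLin_eq_one i
  -- An interior point can be moved both ways along a direction in which the normal root has slope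
  -- 1, so the bounds 0 and 1 are strict.
  have hnear : ∀ᶠ s : ℝ in nhds 0, z + s • d ∈ t.chamber := by
    have hc : Filter.Tendsto (fun s : ℝ => z + s • d) (nhds 0) (nhds z) := by
      have : Continuous fun s : ℝ => z + s • d := by fun_prop
      simpa using this.tendsto 0
    exact hc (isOpen_interior.mem_nhds hz)
  obtain ⟨ε, hε, hball⟩ := Metric.eventually_nhds_iff.mp hnear
  have hval : ∀ s : ℝ, |s| < ε → t.rootEval (normalRoot i) z + s ∈ Set.Icc (0 : ℝ) 1 := by
    intro s hs
    have := hsub (hball (y := s) (by simpa using hs))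
    rwa [Set.mem_preimage, rootEval_add, rootLin_smul, hd, mul_one] at this
  have h1 := hval (ε / 2) (by rw [abs_of_pos] <;> linarith)
  have h2 := hval (-(ε / 2)) (by rw [abs_neg, abs_of_pos] <;> linarith)
  exact ⟨by linarith [h2.1], by linarith [h1.2]⟩

/-- The normal root maps a connected set to an interval. To leave (0, 1) it would have to take the
value 0 or 1, and both level lines are walls: those of α and of the root δ - α. Conversely, the
strip is convex and avoids the walls. -/
theorem fundamentalStrip_eq (i : Fin 2) :
    fundamentalStrip cs i = t.rootEval (normalRoot i) ⁻¹' Set.Ioo 0 1 := by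
  have hcomp : ∀ z ∈ t.chamber, connectedComponentIn (parallelWalls cs (t.direction i))ᶜ z =
      t.rootEval (normalRoot i) ⁻¹' Set.Ioo 0 1 := by
    intro z hz
    have hzS := t.chamber_subset i hz
    have hsub : t.rootEval (normalRoot i) ⁻¹' Set.Ioo 0 1 ⊆
        (parallelWalls cs (t.direction i))ᶜ := fun x hx => notMem_parallelWalls cs hx.1 hx.2
    refine Set.Subset.antisymm ?_ ?_
    · intro x hx
      have hconn := (isPreconnected_connectedComponentIn (x := z)
        (F := (parallelWalls cs (t.direction i))ᶜ)).image _
        (t.continuous_rootEval (normalRoot i)).continuousOn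
      have hord := hconn.ordConnected
      have hxI := Set.mem_image_of_mem (t.rootEval (normalRoot i)) hx
      have hzI := Set.mem_image_of_mem (t.rootEval (normalRoot i))
        (mem_connectedComponentIn (hsub hzS))
      constructor
      · by_contra hneg
        obtain ⟨y, hy, hy0⟩ := hord.out hxI hzI ⟨not_lt.mp hneg, hzS.1.le⟩
        refine connectedComponentIn_subset _ _ hy (mem_parallelWalls_of_root cs (w := 1)
          (k := ![1, 0] i) ?_ ?_)
        · rw [rootRep_one]; exact t.rootLin_normalRoot i
        · rw [rootRep_one]; exact hy0
      · by_contra hneg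
        obtain ⟨y, hy, hy0⟩ := hord.out hzI hxI ⟨hzS.2.le, not_lt.mp hneg⟩
        obtain ⟨w, k, hw⟩ := exists_rootRep_eq_delta_sub cs i
        refine connectedComponentIn_subset _ _ hy (mem_parallelWalls_of_root cs (w := w)
          (k := k) ?_ ?_)
        · rw [hw, sub_rootLin, rootLin_delta, rootLin_normalRoot, sub_zero]
        · rw [hw, sub_rootEval, rootEval_delta, hy0, sub_self]
    · exact (t.convex_preimage_rootEval _ (convex_Ioo 0 1)).isPreconnected.subset_connectedComponentIn
        hzS hsub
  rw [fundamentalStrip, Set.iUnion₂_congr hcomp]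
  exact Set.biUnion_const t.chamber_nonempty _

theorem image_planeAction_preimage (w : W) (p : Fin 3 → ℤ) (s : Set ℝ) :
    planeAction cs w '' (t.rootEval p ⁻¹' s) = t.rootEval (rootRep cs w p) ⁻¹' s := by
  ext z
  constructor
  · rintro ⟨x, hx, rfl⟩
    rwa [Set.mem_preimage, rootEval_rootRep]
  · intro hz
    refine ⟨planeAction cs w⁻¹ z, ?_, planeAction_cancel_inv cs w z⟩
    rwa [Set.mem_preimage, rootEval_planeAction, inv_inv]

theorem strip_eq (g : W) (i : Fin 2) :
    strip cs g i = t.rootEval (rootRep cs g (normalRoot i)) ⁻¹' Set.Ioo 0 1 := by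
  rw [strip, fundamentalStrip_eq, image_planeAction_preimage]

theorem rootEval_surjective (g : W) (i : Fin 2) :
    Function.Surjective (t.rootEval (rootRep cs g (normalRoot i))) := by
  intro c
  obtain ⟨d, hd⟩ := t.exists_rootLin_eq_one i
  refine ⟨planeAction cs g (0 + (c - t.rootEval (normalRoot i) 0) • d), ?_⟩
  rw [rootEval_rootRep, rootEval_add, rootLin_smul, hd]
  ring

theorem mem_middleLine_iff (g : W) (i : Fin 2) (z : ℂ) :
    z ∈ middleLine (strip cs g i) ↔ t.rootEval (rootRep cs g (normalRoot i)) z = 1 / 2 := by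
  rw [strip_eq, middleLine, Set.mem_ofPred_eq]
  have hpt : ∀ x, t.rootEval (rootRep cs g (normalRoot i)) (Equiv.pointReflection z x) =
      2 * t.rootEval (rootRep cs g (normalRoot i)) z -
        t.rootEval (rootRep cs g (normalRoot i)) x := by
    intro x
    have h1 : Equiv.pointReflection z x = (2 : ℝ) • z + (-1 : ℝ) • x := by
      rw [Equiv.pointReflection_apply]
      simp only [vsub_eq_sub, vadd_eq_add, Complex.real_smul]
      push_cast
      ring
    rw [h1, rootEval_combination _ _ _ _ (by norm_num)]
    ring
  have hiff : Equiv.pointReflection z '' (t.rootEval (rootRep cs g (normalRoot i)) ⁻¹' Set.Ioo 0 1)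
      = (Equiv.pointReflection z) ⁻¹' (t.rootEval (rootRep cs g (normalRoot i)) ⁻¹' Set.Ioo 0 1) := by
    rw [Equiv.image_eq_preimage_symm, Equiv.pointReflection_symm]
  rw [hiff]
  constructor
  · intro h
    have key : ∀ y : ℝ, y ∈ Set.Ioo (0 : ℝ) 1 →
        2 * t.rootEval (rootRep cs g (normalRoot i)) z - y ∈ Set.Ioo (0 : ℝ) 1 := by
      intro y hy
      obtain ⟨x, rfl⟩ := rootEval_surjective cs g i y
      have hx : x ∈ t.rootEval (rootRep cs g (normalRoot i)) ⁻¹' Set.Ioo 0 1 := hy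
      rw [← h] at hx
      simpa only [Set.mem_preimage, hpt] using hx
    set c := t.rootEval (rootRep cs g (normalRoot i)) z
    have h1 := key (1 / 2) (by norm_num)
    have h2 := key (c / 2 + 1 / 4) ⟨by linarith [h1.1, h1.2], by linarith [h1.1, h1.2]⟩
    have hc0 : 1 / 4 < c := by linarith [h1.1]
    have hc1 : c < 3 / 4 := by linarith [h1.2]
    rcases lt_trichotomy c (1 / 2) with hlt | heq | hgt
    · have := key (c + 1 / 2) ⟨by linarith, by linarith⟩
      -- A point at height 2c is reflected to height 0, outside the strip; in the case c > 1/2,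
      -- height 2c - 1 goes to height 1.
      have h3 := key (2 * c) ⟨by linarith, by linarith⟩
      linarith [h3.1]
    · exact heq
    · have h3 := key (2 * c - 1) ⟨by linarith, by linarith⟩
      linarith [h3.2]
  · intro h
    ext x
    simp only [Set.mem_preimage, hpt, h, Set.mem_Ioo]
    constructor <;> rintro ⟨h1, h2⟩ <;> constructor <;> linarith

theorem rootLin_stripDirection (g : W) (i : Fin 2) (p : Fin 3 → ℤ) :
    t.rootLin (rootRep cs g p) (stripDirection cs g i) = t.rootLin p (t.direction i) :=
  rootLin_rootRep cs g p _

end Strips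

/-! ### Stabilizers of strips in terms of the root lattice -/

section StripTranslations

variable {W : Type*} [Group W] {t : AffineType} (cs : CoxeterSystem t.coxeterMatrix W)

/-- `w` acts on the fundamental strip `𝒯ᵢ` as a translation or as a glide reflection, with
translation part proportional to `y`. -/
def IsStripTranslation (i : Fin 2) (w : W) (y : ℤ) : Prop :=
  (rootRep cs w (normalRoot i) = normalRoot i ∨
    rootRep cs w (normalRoot i) = t.delta - normalRoot i) ∧
  rootRep cs w (t.tangentVector i) = t.tangentVector i - y • t.delta

/-- The difference from the tangent vector vanishes on vᵢ, so it is a combination of the normal root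
and δ; orthogonality removes the normal root. -/
theorem AffineType.eq_tangentVector_sub (t : AffineType) (i : Fin 2) {p : Fin 3 → ℤ}
    (hlin : t.rootLin p (t.direction i) = t.rootLin (t.tangentVector i) (t.direction i))
    (hform : t.rootForm p (normalRoot i) = 0) : ∃ y : ℤ, p = t.tangentVector i - y • t.delta := by
  have h := t.eq_of_rootLin_direction_eq_zero i (p := p - t.tangentVector i)
    (by rw [sub_rootLin, hlin, sub_self])
  refine ⟨t.tangentVector i 2 - p 2, ?_⟩
  ext l
  cases t <;> fin_cases i <;> fin_cases l <;>
    simp [delta, tangentVector, rootForm, normalRoot_apply] at h hform ⊢ <;> linarith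

theorem exists_mem_middleLine (g : W) (i : Fin 2) : ∃ z, z ∈ middleLine (strip cs g i) := by
  obtain ⟨z, hz⟩ := rootEval_surjective cs g i (1 / 2)
  exact ⟨z, (mem_middleLine_iff cs g i z).mpr hz⟩

/-- At a point of the middle line p takes the value n ± 1/2, which must lie in (0, 1); this
determines n. -/
theorem eq_of_preimage_Ioo_eq {g : W} {i : Fin 2} {p : Fin 3 → ℤ} {n : ℤ}
    (hp : p = rootRep cs g (normalRoot i) + n • t.delta ∨
      p = - rootRep cs g (normalRoot i) + n • t.delta)
    (h : t.rootEval p ⁻¹' Set.Ioo 0 1 = t.rootEval (rootRep cs g (normalRoot i)) ⁻¹' Set.Ioo 0 1) :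
    p = rootRep cs g (normalRoot i) ∨ p = t.delta - rootRep cs g (normalRoot i) := by
  obtain ⟨z, hz⟩ := rootEval_surjective cs g i (1 / 2)
  have hmem : z ∈ t.rootEval p ⁻¹' Set.Ioo 0 1 := by
    rw [h, Set.mem_preimage, hz]
    norm_num
  obtain ⟨h0, h1⟩ := hmem
  rcases hp with hp | hp
  · left
    rw [hp, add_rootEval, smul_rootEval, rootEval_delta, hz] at h0 h1
    have h2 : (n : ℝ) < 1 := by linarith
    have h3 : (-1 : ℝ) < n := by linarith
    norm_cast at h2 h3
    obtain rfl : n = 0 := by omega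
    rw [hp, zero_smul, add_zero]
  · right
    rw [hp, add_rootEval, smul_rootEval, rootEval_delta, neg_rootEval, hz] at h0 h1
    have h2 : (n : ℝ) < 2 := by linarith
    have h3 : (0 : ℝ) < n := by linarith
    norm_cast at h2 h3
    obtain rfl : n = 1 := by omega
    rw [hp, one_smul, neg_add_eq_sub]

/-- Preserving the direction forces the normal root to go to ± itself modulo δ, and preserving the
strip fixes the multiple of δ. The value y is the growth of the tangent vector along the
translation. -/
theorem isStripTranslation_of_mem {g w : W} {i : Fin 2} {c : ℝ}
    (hw : w ∈ stripStabilizer cs g i) (hc : TranslatesMiddleLine cs g i w c) :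
    ∃ y : ℤ, IsStripTranslation cs i (g⁻¹ * w * g) y ∧
      y = c * t.rootLin (t.tangentVector i) (t.direction i) := by
  obtain ⟨hstrip, hdir⟩ := hw
  have hconj : ∀ p, rootRep cs w (rootRep cs g p) = rootRep cs g (rootRep cs (g⁻¹ * w * g) p) := by
    intro p
    rw [← rootRep_mul, ← rootRep_mul]
    congr 2
    group
  have hlin : ∀ p, t.rootLin (rootRep cs (g⁻¹ * w * g) p) (t.direction i) =
      t.rootLin p (t.direction i) := by
    intro p
    rw [← rootLin_stripDirection cs g, ← hconj]
    conv_lhs => rw [← hdir]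
    rw [rootLin_rootRep, rootLin_stripDirection]
  have hnormal : rootRep cs (g⁻¹ * w * g) (normalRoot i) = normalRoot i ∨
      rootRep cs (g⁻¹ * w * g) (normalRoot i) = t.delta - normalRoot i := by
    obtain ⟨n, hn⟩ := root_classification cs (g⁻¹ * w * g) (![1, 0] i) i
      (by rw [hlin]; exact t.rootLin_normalRoot i)
    have h1 : t.rootEval (rootRep cs w (rootRep cs g (normalRoot i))) ⁻¹' Set.Ioo 0 1 =
        t.rootEval (rootRep cs g (normalRoot i)) ⁻¹' Set.Ioo 0 1 := by
      rw [← image_planeAction_preimage, ← strip_eq, hstrip]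
    refine (eq_of_preimage_Ioo_eq cs (n := n) ?_ h1).imp (fun h => ?_) (fun h => ?_)
    · rw [hconj]
      refine hn.imp (fun h => ?_) (fun h => ?_)
      · rw [h, map_add, map_smul, rootRep_delta]
      · rw [h, map_add, map_smul, rootRep_delta, map_neg]
    · rw [hconj] at h
      exact rootRep_injective cs g h
    · rw [hconj] at h
      apply rootRep_injective cs g
      rw [h, map_sub, rootRep_delta]
  have hform : t.rootForm (rootRep cs (g⁻¹ * w * g) (t.tangentVector i)) (normalRoot i) = 0 := by
    have h0 : t.rootForm (t.tangentVector i) (normalRoot i) = 0 := by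
      cases t <;> fin_cases i <;> rfl
    have h1 := rootForm_rootRep cs (g⁻¹ * w * g) (t.tangentVector i) (normalRoot i)
    rw [h0] at h1
    rcases hnormal with h | h
    · rwa [h] at h1
    -- δ lies in the radical of the form, so replacing α by δ - α only changes the sign of the
    -- pairing.
    · rw [h] at h1
      rw [← neg_eq_zero, ← h1]
      cases t <;> fin_cases i <;> simp [rootForm, delta, normalRoot_apply] <;> ring
  obtain ⟨y, hy⟩ := t.eq_tangentVector_sub i (hlin _) hform
  refine ⟨y, ⟨hnormal, hy⟩, ?_⟩
  obtain ⟨z, hz⟩ := exists_mem_middleLine cs g i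
  have h1 := rootEval_rootRep cs w (rootRep cs g (t.tangentVector i)) z
  rw [hconj, hy, map_sub, map_smul, rootRep_delta, hc z hz, sub_rootEval, smul_rootEval,
    rootEval_delta, rootEval_add, rootLin_smul, rootLin_stripDirection] at h1
  linarith

/-- The linear parts of the normal root and the tangent vector separate points, so the direction and
the motion of the middle line can be tested on these two functions. The reflection α ↦ δ - α
preserves the value 1/2. -/
theorem mem_of_isStripTranslation {g w : W} {i : Fin 2} {y : ℤ} {c : ℝ}
    (h : IsStripTranslation cs i (g⁻¹ * w * g) y)
    (hc : y = c * t.rootLin (t.tangentVector i) (t.direction i)) :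
    w ∈ stripStabilizer cs g i ∧ TranslatesMiddleLine cs g i w c := by
  obtain ⟨hnormal, htangent⟩ := h
  have hconj : ∀ p, rootRep cs w (rootRep cs g p) = rootRep cs g (rootRep cs (g⁻¹ * w * g) p) := by
    intro p
    rw [← rootRep_mul, ← rootRep_mul]
    congr 2
    group
  have htan : rootRep cs w (rootRep cs g (t.tangentVector i)) =
      rootRep cs g (t.tangentVector i) - y • t.delta := by
    rw [hconj, htangent, map_sub, map_smul, rootRep_delta]
  have hnor : rootRep cs w (rootRep cs g (normalRoot i)) = rootRep cs g (normalRoot i) ∨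
      rootRep cs w (rootRep cs g (normalRoot i)) = t.delta - rootRep cs g (normalRoot i) := by
    rw [hconj]
    refine hnormal.imp (fun h => ?_) (fun h => ?_)
    · rw [h]
    · rw [h, map_sub, rootRep_delta]
  have hzero : ∀ d : ℂ, t.rootLin (rootRep cs g (normalRoot i)) d = 0 →
      t.rootLin (rootRep cs g (t.tangentVector i)) d = 0 → d = 0 := by
    intro d h1 h2
    obtain ⟨e, rfl⟩ := (planeAction cs g).linearIsometryEquiv.surjective d
    rw [rootLin_rootRep] at h1 h2
    rw [t.eq_zero_of_rootLin i h1 h2, map_zero]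
  refine ⟨⟨?_, ?_⟩, ?_⟩
  · rw [strip_eq, image_planeAction_preimage]
    rcases hnor with h | h
    · rw [h]
    · rw [h]
      ext z
      simp only [Set.mem_preimage, sub_rootEval, rootEval_delta, Set.mem_Ioo]
      constructor <;> rintro ⟨h1, h2⟩ <;> constructor <;> linarith
  · have h0 : t.rootLin (rootRep cs g (normalRoot i)) (stripDirection cs g i) = 0 := by
      rw [rootLin_stripDirection, rootLin_normalRoot]
    refine sub_eq_zero.mp (hzero _ ?_ ?_)
    · rw [rootLin_sub, h0, sub_zero]
      have h1 := rootLin_rootRep cs w (rootRep cs g (normalRoot i)) (stripDirection cs g i)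
      rw [h0] at h1
      rcases hnor with h | h
      · rwa [h] at h1
      · rw [h, sub_rootLin, rootLin_delta, zero_sub, neg_eq_zero] at h1
        exact h1
    · have h1 := rootLin_rootRep cs w (rootRep cs g (t.tangentVector i)) (stripDirection cs g i)
      rw [htan, sub_rootLin, smul_rootLin, rootLin_delta, mul_zero, sub_zero] at h1
      rw [rootLin_sub, h1, sub_self]
  · intro z hz
    rw [mem_middleLine_iff] at hz
    have key : ∀ p, t.rootLin p (planeAction cs w z - (z + c • stripDirection cs g i)) =
        t.rootEval p (planeAction cs w z) -
          (t.rootEval p z + c * t.rootLin p (stripDirection cs g i)) := by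
      intro p
      rw [← rootLin_smul, ← rootEval_add, eq_sub_iff_add_eq', ← rootEval_add, add_sub_cancel]
    refine sub_eq_zero.mp (hzero _ ?_ ?_)
    · rw [key, rootLin_stripDirection, rootLin_normalRoot, hz]
      have h1 := rootEval_rootRep cs w (rootRep cs g (normalRoot i)) z
      rw [hz] at h1
      rcases hnor with h | h
      · rw [h] at h1
        rw [h1]
        ring
      · rw [h, sub_rootEval, rootEval_delta] at h1
        linarith
    · have h1 := rootEval_rootRep cs w (rootRep cs g (t.tangentVector i)) z
      rw [htan, sub_rootEval, smul_rootEval, rootEval_delta] at h1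
      rw [key, rootLin_stripDirection, ← hc]
      linarith

/-- The translation length of the generator of the stabilizer of a strip, in units of
`tangentVector`. -/
def AffineType.period : AffineType → Fin 2 → ℤ
  | A2 => ![3, 3]
  | C2 => ![2, 2]
  | G2 => ![1, 2]

/-- A vector fixed modulo m by the simple reflections is fixed modulo m by all of W. This yields the
congruences that bound translation lengths. -/
theorem exists_rootRep_eq_add_smul (m : ℤ) (p : Fin 3 → ℤ)
    (h : ∀ i l, m ∣ t.reflectRoot i p l - p l) (w : W) :
    ∃ v : Fin 3 → ℤ, rootRep cs w p = p + m • v := by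
  induction w using cs.simple_induction_left with
  | one => exact ⟨0, by rw [rootRep_one, smul_zero, add_zero]⟩
  | mul_simple_left w i ih =>
    obtain ⟨v, hv⟩ := ih
    choose v' hv' using h i
    refine ⟨v' + rootRep cs (cs.simple i) v, ?_⟩
    rw [rootRep_mul, hv, map_add, map_smul, smul_add, ← add_assoc]
    congr 1
    ext l
    rw [rootRep_simple, Pi.add_apply, Pi.smul_apply, smul_eq_mul, ← hv' l, add_sub_cancel]

theorem rootRep_delta_expand (w : W) (l : Fin 3) :
    t.delta 0 * rootRep cs w (simpleRoot 0) l + t.delta 1 * rootRep cs w (simpleRoot 1) l +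
      t.delta 2 * rootRep cs w (simpleRoot 2) l = t.delta l := by
  have h := congrFun (rootRep_delta cs w) l
  rw [rootRep_apply_eq_sum, Fin.sum_univ_three] at h
  simpa using h

end StripTranslations

/-! ### The minimal translation along a strip -/

section StripGenerators

variable {W : Type*} [Group W] {t : AffineType} (cs : CoxeterSystem t.coxeterMatrix W)

/-- Everything is read off from the last coordinate, where δ has coefficient 1. At the minimal y the
element is a pure translation only for the first strip in type C̃₂; otherwise it is a glide
reflection. -/
theorem period_le_of_isStripTranslation {i : Fin 2} {w : W} {y : ℤ}
    (h : IsStripTranslation cs i w y) (hy : 0 < y) : t.period i ≤ y ∧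
      (y = t.period i → (rootRep cs w (normalRoot i) = normalRoot i ↔ t = C2 ∧ i = 0)) := by
  obtain ⟨hn, ht⟩ := h
  have hne : normalRoot i ≠ t.delta - normalRoot i := by
    intro e
    have := congrFun e 2
    cases t <;> fin_cases i <;> simp [delta, normalRoot_apply] at this
  suffices H : (rootRep cs w (normalRoot i) = normalRoot i →
        t.period i ≤ y ∧ (y = t.period i → t = C2 ∧ i = 0)) ∧
      (rootRep cs w (normalRoot i) = t.delta - normalRoot i →
        t.period i ≤ y ∧ (y = t.period i → ¬ (t = C2 ∧ i = 0))) by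
    rcases hn with hn | hn
    · exact ⟨(H.1 hn).1, fun h => ⟨fun _ => (H.1 hn).2 h, fun _ => hn⟩⟩
    · exact ⟨(H.2 hn).1, fun h => ⟨fun e => absurd (e.symm.trans hn) hne,
        fun e => absurd e ((H.2 hn).2 h)⟩⟩
  clear hn hne
  have hδ := rootRep_delta_expand cs w 2
  replace ht := congrFun ht 2
  rw [rootRep_apply_eq_sum, Fin.sum_univ_three] at ht
  -- In type Ã₂ the class of α₁ - α₂ modulo 3 is invariant; in type C̃₂, below, those of α₂ and α₃
  -- modulo 2 are. In type G̃₂ the relation wδ = δ suffices.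
  have hA : t = A2 → ∃ v, rootRep cs w (simpleRoot 0 - simpleRoot 1) 2 = 3 * v := by
    rintro rfl
    obtain ⟨v, hv⟩ := exists_rootRep_eq_add_smul cs 3 (simpleRoot 0 - simpleRoot 1)
      (by decide +kernel) w
    exact ⟨v 2, by rw [hv]; simp⟩
  have hC : t = C2 → ∃ v v', rootRep cs w (simpleRoot 1) 2 = 2 * v ∧
      rootRep cs w (simpleRoot 2) 2 = 1 + 2 * v' := by
    rintro rfl
    obtain ⟨v, hv⟩ := exists_rootRep_eq_add_smul cs 2 (simpleRoot 1) (by decide +kernel) w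
    obtain ⟨v', hv'⟩ := exists_rootRep_eq_add_smul cs 2 (simpleRoot 2) (by decide +kernel) w
    exact ⟨v 2, v' 2, by rw [hv]; simp, by rw [hv']; simp⟩
  constructor <;> intro hn <;>
    replace hn : rootRep cs w (simpleRoot (![1, 0] i)) 2 = _ := congrFun hn 2 <;> cases t <;> fin_cases i <;>
    simp [period, tangentVector, delta, normalRoot_apply] at hA hC ht hδ hn ⊢ <;> omega

/-- The minimal value of y also decides between α and δ - α. Hence both elements agree on three
vectors that span the lattice rationally, and the action is faithful. -/
theorem IsStripTranslation.eq {i : Fin 2} {w v : W} (hw : IsStripTranslation cs i w (t.period i))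
    (hv : IsStripTranslation cs i v (t.period i)) : w = v := by
  have hpos : 0 < t.period i := by
    cases t <;> fin_cases i <;> simp [period]
  have hnormal : rootRep cs w (normalRoot i) = rootRep cs v (normalRoot i) := by
    have h1 := (period_le_of_isStripTranslation cs hw hpos).2 rfl
    have h2 := (period_le_of_isStripTranslation cs hv hpos).2 rfl
    by_cases h : t = C2 ∧ i = 0
    · rw [h1.mpr h, h2.mpr h]
    · rw [hw.1.resolve_left (mt h1.mp h), hv.1.resolve_left (mt h2.mp h)]
  have htangent := hw.2.trans hv.2.symm
  refine eq_of_rootRep_simpleRoot cs fun k => ?_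
  -- The three vectors need not span the lattice over the integers, so a multiple c of the simple
  -- root is expressed; c cancels since the lattice is torsion-free.
  obtain ⟨c, x, y, z, hc, h⟩ : ∃ c x y z : ℤ, c ≠ 0 ∧
      c • simpleRoot k = x • normalRoot i + y • t.tangentVector i + z • t.delta := by
    have key : ∀ k, ∃ c x y z : ℤ, c ≠ 0 ∧ ∀ l,
        c * simpleRoot k l = x * normalRoot i l + y * t.tangentVector i l + z * t.delta l := by
      cases t <;> fin_cases i <;> intro k <;> fin_cases k
      · exact ⟨2, -1, 1, 1, by decide +kernel⟩
      · exact ⟨1, 1, 0, 0, by decide +kernel⟩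
      · exact ⟨2, -1, -1, 1, by decide +kernel⟩
      · exact ⟨1, 1, 0, 0, by decide +kernel⟩
      · exact ⟨2, -1, 1, 1, by decide +kernel⟩
      · exact ⟨2, -1, -1, 1, by decide +kernel⟩
      · exact ⟨2, -1, 1, 1, by decide +kernel⟩
      · exact ⟨1, 1, 0, 0, by decide +kernel⟩
      · exact ⟨1, 0, -1, 0, by decide +kernel⟩
      · exact ⟨1, 1, 0, 0, by decide +kernel⟩
      · exact ⟨2, -2, 1, 1, by decide +kernel⟩
      · exact ⟨2, -2, -1, 1, by decide +kernel⟩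
      · exact ⟨2, -3, 1, 1, by decide +kernel⟩
      · exact ⟨1, 1, 0, 0, by decide +kernel⟩
      · exact ⟨1, 0, -1, 0, by decide +kernel⟩
      · exact ⟨1, 1, 0, 0, by decide +kernel⟩
      · exact ⟨4, -2, 1, 1, by decide +kernel⟩
      · exact ⟨4, -2, -3, 1, by decide +kernel⟩
    obtain ⟨c, x, y, z, hc, h⟩ := key k
    exact ⟨c, x, y, z, hc, funext h⟩
  apply smul_right_injective _ hc
  dsimp only
  rw [← map_smul, ← map_smul, h]
  simp only [map_add, map_smul, hnormal, htangent, rootRep_delta]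

theorem isStripTranslation_stripWord (i : Fin 2) : IsStripTranslation cs i
    ((standardShift cs i)⁻¹ * cs.wordProd (t.stripWord i) * standardShift cs i) (t.period i) := by
  obtain ⟨ω, hω, h1, h2⟩ : ∃ ω : List (Fin 3),
      (standardShift cs i)⁻¹ * cs.wordProd (t.stripWord i) * standardShift cs i = cs.wordProd ω ∧
      ((∀ l, ω.foldr t.reflectRoot (normalRoot i) l = normalRoot i l) ∨
        ∀ l, ω.foldr t.reflectRoot (normalRoot i) l = (t.delta - normalRoot i) l) ∧
      ∀ l, ω.foldr t.reflectRoot (t.tangentVector i) l =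
        (t.tangentVector i - t.period i • t.delta) l := by
    have hword : ∀ ω : List (Fin 3), (1 : W)⁻¹ * cs.wordProd ω * 1 = cs.wordProd ω := by simp
    cases t <;> fin_cases i
    · exact ⟨_, hword _, by decide +kernel, by decide +kernel⟩
    · exact ⟨_, hword _, by decide +kernel, by decide +kernel⟩
    · exact ⟨_, hword _, by decide +kernel, by decide +kernel⟩
    · exact ⟨_, hword _, by decide +kernel, by decide +kernel⟩
    -- The only case with a nontrivial shift: conjugating s₃s₁s₂ by s₁ gives s₁s₃s₁s₂s₁.
    · refine ⟨[0, 2, 0, 1, 0], ?_, by decide +kernel, by decide +kernel⟩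
      simp [standardShift, stripWord, cs.wordProd_cons, mul_assoc]
    · exact ⟨_, hword _, by decide +kernel, by decide +kernel⟩
  rw [hω, IsStripTranslation, rootRep_wordProd, rootRep_wordProd]
  exact ⟨h1.imp funext funext, funext h2⟩

theorem isStripGenerator_iff (i : Fin 2) (w : W) :
    IsStripGenerator cs i w ↔ w = cs.wordProd (t.stripWord i) := by
  have hκ := t.rootLin_tangentVector_pos i
  have hpos : (0 : ℝ) < t.period i := by
    cases t <;> fin_cases i <;> simp [period]
  have hword := isStripTranslation_stripWord cs i
  -- The translation length is the period divided by the slope of the tangent vector along vᵢ.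
  obtain ⟨hmem, htr⟩ := mem_of_isStripTranslation cs hword (div_mul_cancel₀ _ hκ.ne').symm
  have hmin : ∀ w' ∈ stripStabilizer cs (standardShift cs i) i, ∀ c' : ℝ, 0 < c' →
      TranslatesMiddleLine cs (standardShift cs i) i w' c' →
      t.period i / t.rootLin (t.tangentVector i) (t.direction i) ≤ c' := by
    intro w' hw' c' hc' h
    obtain ⟨y, hy, hyc⟩ := isStripTranslation_of_mem cs hw' h
    have hy0 : 0 < y := by
      have : (0 : ℝ) < y := hyc ▸ mul_pos hc' hκ
      exact_mod_cast this
    rw [div_le_iff₀ hκ, ← hyc]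
    exact_mod_cast (period_le_of_isStripTranslation cs hy hy0).1
  constructor
  · rintro ⟨hw, c, hc, h, hle⟩
    obtain rfl : c = t.period i / t.rootLin (t.tangentVector i) (t.direction i) :=
      le_antisymm (hle _ hmem _ (div_pos hpos hκ) htr) (hmin _ hw _ hc h)
    obtain ⟨y, hy, hyc⟩ := isStripTranslation_of_mem cs hw h
    rw [div_mul_cancel₀ _ hκ.ne'] at hyc
    obtain rfl : y = t.period i := by exact_mod_cast hyc
    simpa using hy.eq cs hword
  · rintro rfl
    exact ⟨hmem, _, div_pos hpos hκ, htr, hmin⟩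

end StripGenerators

end

theorem mainTheorem2 (t : AffineType) {W : Type*} [Group W]
    (cs : CoxeterSystem t.coxeterMatrix W) :
    (∀ i : Fin 2, ∃! w : W, IsStripGenerator cs i w) ∧
    ∀ w : Fin 2 → W, (∀ i, IsStripGenerator cs i (w i)) →
      ∀ {k : Type*} [CommRing k] (q : k) {V : Type*} [AddCommGroup V] [Module k V]
        (ρ : HeckeAlgebra cs q →ₐ[k] Module.End k V),
        ∃ l : List FactorLabel, l.Nodup ∧ (∀ x, x ∈ l) ∧
          ((l.map (factor cs ρ w)).prod : PowerSeries (Module.End k V)) =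
            poincareSeries cs ρ Set.univ := by
  refine ⟨fun i => ⟨_, (isStripGenerator_iff cs i _).mpr rfl,
    fun w => (isStripGenerator_iff cs i w).mp⟩, fun w hw k _ q V _ _ ρ => ?_⟩
  obtain rfl : w = fun i => cs.wordProd (t.stripWord i) :=
    funext fun i => (isStripGenerator_iff cs i _).mp (hw i)
  cases t
  · exact exists_ordering_A2 cs ρ
  · exact exists_ordering_C2 cs ρ
  · exact exists_ordering_G2 cs ρ
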